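/- Let $k$ be a commutative ring and $H$ a Hopf algebra over $k$ with bijective antipode $S$; write $\otimes=\otimes_k$. For a right $H$-comodule $(M,\rho)$, $\rho(m)=m_{[0]}\otimes m_{[1]}$, let $M^{{\rm co}H}=\{m\in M\mid\rho(m)=m\otimes 1\}$. A right $H$-comodule algebra $A$ is a *right faithfully flat $H$-Galois extension* if $A$ is faithfully flat as a right $A^{{\rm co}H}$-module and the map ${\rm can}'\colon A\otimes_{A^{{\rm co}H}}A\to A\otimes H$, $a\otimes b\mapsto a_{[0]}b\otimes a_{[1]}$, is bijective. Then (as $S$ is bijective) the map ${\rm can}(a\otimes b)=ab_{[0]}\otimes b_{[1]}$ is bijective as well, and we write $\gamma_A(h)={\rm can}^{-1}(1\otimes h)=\sum_i l_i(h)\otimes_{A^{{\rm co}H}}r_i(h)$ for $h\in H$. For right $A$-modules $P,Q$, the *Miyashita-Ulbrich action* of $H$ on ${\rm Hom}_{A^{{\rm co}H}}(P,Q)$ (right $A^{{\rm co}H}$-linear maps) is $(f\leftharpoonup h)(p)=\sum_i f(p\,l_i(h))\,r_i(h)$. For right $H$-comodule algebras $A,B$, a *two-sided relative Hopf module* $M\in{}_A\mathcal{M}_B^H$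 is an $(A,B)$-bimodule (with the same induced $k$-module structure on both sides) and right $H$-comodule with $\rho(amb)=a_{[0]}m_{[0]}b_{[0]}\otimes a_{[1]}m_{[1]}b_{[1]}$. An *$H$-Morita context* $(A,B,M,N,\alpha,\beta)$ consists of $M\in{}_A\mathcal{M}_B^H$, $N\in{}_B\mathcal{M}_A^H$, an $(A,A)$-bilinear $H$-colinear map $\alpha\colon M\otimes_BN\to A$ and a $(B,B)$-bilinear $H$-colinear map $\beta\colon N\otimes_AM\to B$ (where tensor products carry the coaction $m\otimes n\mapsto m_{[0]}\otimes n_{[0]}\otimes m_{[1]}n_{[1]}$) such that $\alpha(m\otimes n)m'=m\,\beta(n\otimes m')$ and $\beta(n\otimes m)n'=n\,\alpha(m\otimes n')$. It is *strict* if $\alpha$ and $\beta$ are isomorphisms. **Proposition.** Let $(A,B,M,N,\alpha,\beta)$ be a strict $H$-Morita context between right faithfully flat $H$-Galois extensions $A$ and $B$, and let $X$, $Y$ be right $A$-modules. Then the maps $X\otimes_{A^{{\rm co}H}}M^{{\rm co}H}\to X\otimes_AM$ and $Y\otimes_{A^{{\rm co}H}}M^{{\rm co}H}\to Y\otimes_AM$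 given by $x\otimes m\mapsto x\otimes m$ are bijective; regard $X\otimes_{A^{{\rm co}H}}M^{{\rm co}H}$ and $Y\otimes_{A^{{\rm co}H}}M^{{\rm co}H}$ as right $B$-modules by transporting along these maps the right $B$-actions $(x\otimes m)b=x\otimes mb$ of $X\otimes_AM$ and $Y\otimes_AM$ (they extend the right $B^{{\rm co}H}$-actions that come from $M^{{\rm co}H}$). The map $$\phi\colon{\rm Hom}_{A^{{\rm co}H}}(X,Y)\to{\rm Hom}_{B^{{\rm co}H}}\bigl(X\otimes_{A^{{\rm co}H}}M^{{\rm co}H},\,Y\otimes_{A^{{\rm co}H}}M^{{\rm co}H}\bigr),\qquad \phi(f)=f\otimes_{A^{{\rm co}H}}M^{{\rm co}H},$$ is an isomorphism of $k$-modules, and it preserves the Miyashita-Ulbrich action: $\phi(f\leftharpoonup h)=\phi(f)\leftharpoonup h$ for all $f\in{\rm Hom}_{A^{{\rm co}H}}(X,Y)$ and $h\in H$, where the left-hand side uses $\gamma_A$ and the right-hand side uses $\gamma_B$ and the transported right $B$-actions. -/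

import Mathlib

open TensorProduct MulOpposite

universe u

namespace HMorita

/-! ### Right modules

A right module over a ring `R` is a module over `Rᵐᵒᵖ`; `op r • x` is the product `x r`. -/

section Restriction

variable {k A X : Type*} [CommRing k] [Ring A] [Algebra k A] [AddCommGroup X]

/-- Restriction of scalars of a right module to a subalgebra. -/
instance (priority := low) subalgebraRightModule (S : Subalgebra k A) [Module Aᵐᵒᵖ X] :
    Module (↥S)ᵐᵒᵖ X :=
  Module.compHom X (RingHom.op (S.val : ↥S →+* A))

theorem subalgebra_op_smul (S : Subalgebra k A) [Module Aᵐᵒᵖ X] (s : S) (x : X) :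
    op s • x = op (s : A) • x := rfl

instance (priority := low) subalgebraRightTower (S : Subalgebra k A) [Module k X] [Module Aᵐᵒᵖ X]
    [IsScalarTower k Aᵐᵒᵖ X] : IsScalarTower k (↥S)ᵐᵒᵖ X where
  smul_assoc c s x := by
    change (op ((c • s.unop : S) : A)) • x = c • (op (s.unop : A) • x)
    rw [← smul_assoc]
    rfl

instance (priority := low) subalgebraRightComm (S : Subalgebra k A) [Module A X] [Module Aᵐᵒᵖ X]
    [SMulCommClass A Aᵐᵒᵖ X] : SMulCommClass S (↥S)ᵐᵒᵖ X where
  smul_comm s t x := smul_comm (s : A) (op (t.unop : A)) x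

end Restriction

/-! ### The tensor product over a noncommutative ring -/

section Bal

variable (k R : Type*) [CommRing k] [Ring R]
variable (X Y : Type*) [AddCommGroup X] [Module k X] [Module Rᵐᵒᵖ X]
  [AddCommGroup Y] [Module k Y] [Module R Y]

/-- The relations `x r ⊗ y = x ⊗ r y`. -/
def balRel : Submodule k (X ⊗[k] Y) :=
  Submodule.span k {t | ∃ (x : X) (r : R) (y : Y), t = (op r • x) ⊗ₜ[k] y - x ⊗ₜ[k] (r • y)}

/-- The tensor product `X ⊗_R Y` of a right `R`-module and a left `R`-module, where `R` is a
`k`-algebra that need not be commutative: the quotient of `X ⊗_k Y` by the relations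
`x r ⊗ y = x ⊗ r y`. -/
def BalTensor : Type _ := (X ⊗[k] Y) ⧸ balRel k R X Y

instance : AddCommGroup (BalTensor k R X Y) :=
  inferInstanceAs (AddCommGroup ((X ⊗[k] Y) ⧸ balRel k R X Y))

instance : Module k (BalTensor k R X Y) :=
  inferInstanceAs (Module k ((X ⊗[k] Y) ⧸ balRel k R X Y))

namespace BalTensor

variable {X Y}

/-- The pure tensor `x ⊗_R y`, as a bilinear map. -/
def mk : X →ₗ[k] Y →ₗ[k] BalTensor k R X Y :=
  (TensorProduct.mk k X Y).compr₂ (balRel k R X Y).mkQ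

theorem mk_smul (x : X) (r : R) (y : Y) : mk k R (op r • x) y = mk k R x (r • y) := by
  have h : (op r • x) ⊗ₜ[k] y - x ⊗ₜ[k] (r • y) ∈ balRel k R X Y :=
    Submodule.subset_span ⟨x, r, y, rfl⟩
  exact (Submodule.Quotient.eq _).2 h

variable {k R}
variable {Z : Type*} [AddCommGroup Z] [Module k Z]

/-- The universal property: an `R`-balanced `k`-linear map factors through `X ⊗_R Y`. -/
def lift (f : X ⊗[k] Y →ₗ[k] Z)
    (hf : ∀ (x : X) (r : R) (y : Y), f ((op r • x) ⊗ₜ[k] y) = f (x ⊗ₜ[k] (r • y))) :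
    BalTensor k R X Y →ₗ[k] Z :=
  (balRel k R X Y).liftQ f (by
    rw [balRel, Submodule.span_le]
    rintro _ ⟨x, r, y, rfl⟩
    simp [hf])

@[simp] theorem lift_mk (f : X ⊗[k] Y →ₗ[k] Z) (hf) (x : X) (y : Y) :
    lift (R := R) f hf (mk k R x y) = f (x ⊗ₜ[k] y) := rfl

theorem ext {f g : BalTensor k R X Y →ₗ[k] Z} (h : ∀ x y, f (mk k R x y) = g (mk k R x y)) :
    f = g := by
  refine Submodule.linearMap_qext _ (TensorProduct.ext' h)

@[elab_as_elim]
theorem induction {p : BalTensor k R X Y → Prop} (z : BalTensor k R X Y)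
    (zero : p 0) (tmul : ∀ x y, p (mk k R x y)) (add : ∀ a b, p a → p b → p (a + b)) : p z := by
  obtain ⟨t, rfl⟩ := Submodule.Quotient.mk_surjective _ z
  induction t with
  | zero => exact zero
  | tmul x y => exact tmul x y
  | add a b ha hb => exact add _ _ ha hb

end BalTensor

end Bal

section BalMap

variable {k R : Type*} [CommRing k] [Ring R] [Algebra k R]
variable {X X' Y Y' : Type*} [AddCommGroup X] [Module k X] [Module Rᵐᵒᵖ X] [IsScalarTower k Rᵐᵒᵖ X]
  [AddCommGroup X'] [Module k X'] [Module Rᵐᵒᵖ X'] [IsScalarTower k Rᵐᵒᵖ X']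
  [AddCommGroup Y] [Module k Y] [Module R Y] [IsScalarTower k R Y]
  [AddCommGroup Y'] [Module k Y'] [Module R Y'] [IsScalarTower k R Y']

/-- The map `f ⊗_R g`. -/
def BalTensor.map (f : X →ₗ[Rᵐᵒᵖ] X') (g : Y →ₗ[R] Y') :
    BalTensor k R X Y →ₗ[k] BalTensor k R X' Y' :=
  BalTensor.lift
    (TensorProduct.lift ((BalTensor.mk k R).compl₁₂ (f.restrictScalars k) (g.restrictScalars k)))
    (fun x r y => by simp [BalTensor.mk_smul])

@[simp] theorem BalTensor.map_mk (f : X →ₗ[Rᵐᵒᵖ] X') (g : Y →ₗ[R] Y') (x : X) (y : Y) :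
    BalTensor.map (k := k) f g (BalTensor.mk k R x y) = BalTensor.mk k R (f x) (g y) := rfl

end BalMap

section BalRightModule

variable {k R : Type*} [CommRing k] [Ring R]
variable {X Y : Type*} [AddCommGroup X] [Module k X] [Module Rᵐᵒᵖ X]
  [AddCommGroup Y] [Module k Y] [Module R Y]
variable {T : Type*} [Ring T] [Algebra k T] [Module Tᵐᵒᵖ Y] [IsScalarTower k Tᵐᵒᵖ Y]
  [SMulCommClass R Tᵐᵒᵖ Y]

/-- Right multiplication by `t` on `X ⊗_R Y`, for an `(R, T)`-bimodule `Y`: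
`(x ⊗ y) t = x ⊗ y t`. -/
def BalTensor.rightMul (t : Tᵐᵒᵖ) : BalTensor k R X Y →ₗ[k] BalTensor k R X Y :=
  BalTensor.lift
    (TensorProduct.lift ((BalTensor.mk k R).compl₁₂ LinearMap.id (Algebra.lsmul k k Y t)))
    (fun x r y => by simp [BalTensor.mk_smul, smul_comm])

theorem BalTensor.rightMul_mk (t : Tᵐᵒᵖ) (x : X) (y : Y) :
    BalTensor.rightMul t (BalTensor.mk k R x y) = BalTensor.mk k R x (t • y) := rfl

/-- The right `T`-module structure on `X ⊗_R Y`. -/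
instance BalTensor.rightModule : Module Tᵐᵒᵖ (BalTensor k R X Y) where
  smul t z := BalTensor.rightMul t z
  one_smul z := by
    change BalTensor.rightMul (1 : Tᵐᵒᵖ) z = LinearMap.id (R := k) z
    congr 1
    exact BalTensor.ext fun x y => by simp [BalTensor.rightMul_mk]
  mul_smul s t z := by
    change BalTensor.rightMul (s * t) z = (BalTensor.rightMul s ∘ₗ BalTensor.rightMul t) z
    congr 1
    exact BalTensor.ext fun x y => by simp [BalTensor.rightMul_mk, mul_smul]
  smul_zero t := map_zero _
  smul_add t := map_add _
  zero_smul z := by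
    change BalTensor.rightMul (0 : Tᵐᵒᵖ) z = (0 : BalTensor k R X Y →ₗ[k] _) z
    congr 1
    exact BalTensor.ext fun x y => by simp [BalTensor.rightMul_mk]
  add_smul s t z := by
    change BalTensor.rightMul (s + t) z = (BalTensor.rightMul s + BalTensor.rightMul t : BalTensor k R X Y →ₗ[k] _) z
    congr 1
    exact BalTensor.ext fun x y => by simp [BalTensor.rightMul_mk, add_smul]

theorem BalTensor.smul_mk (t : Tᵐᵒᵖ) (x : X) (y : Y) :
    t • BalTensor.mk k R x y = BalTensor.mk k R x (t • y) := rfl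

instance BalTensor.rightTower : IsScalarTower k Tᵐᵒᵖ (BalTensor k R X Y) where
  smul_assoc c t z := by
    change BalTensor.rightMul (c • t) z = (c • BalTensor.rightMul t : BalTensor k R X Y →ₗ[k] _) z
    congr 1
    exact BalTensor.ext fun x y => by simp [BalTensor.rightMul_mk]

end BalRightModule

/-- A right `R`-module `P` is faithfully flat if `P ⊗_R -` preserves injections of left
`R`-modules and `P ⊗_R N = 0` implies `N = 0`. (It is enough to test on modules in the universe
of `R`: flatness is tested on left ideals, and faithfulness on cyclic modules. The `k`-module
structure on a left `R`-module is the one that is induced by the `k`-algebra structure of `R`.) -/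
structure IsRightFaithfullyFlat (k : Type*) (R : Type u) (P : Type*) [CommRing k] [Ring R]
    [Algebra k R] [AddCommGroup P] [Module k P] [Module Rᵐᵒᵖ P] [IsScalarTower k Rᵐᵒᵖ P] :
    Prop where
  flat : ∀ (N N' : Type u) [AddCommGroup N] [Module k N] [Module R N] [IsScalarTower k R N]
    [AddCommGroup N'] [Module k N'] [Module R N'] [IsScalarTower k R N'] (f : N →ₗ[R] N'),
    Function.Injective f →
      Function.Injective (BalTensor.map (k := k) (LinearMap.id : P →ₗ[Rᵐᵒᵖ] P) f)
  faithful : ∀ (N : Type u) [AddCommGroup N] [Module k N] [Module R N] [IsScalarTower k R N],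
    Subsingleton (BalTensor k R P N) → Subsingleton N

/-! ### Comodules, comodule algebras, relative Hopf modules -/

/-- A right `H`-comodule: a coassociative and counital coaction `ρ : M → M ⊗ H`. -/
class HComodule (k H M : Type*) [CommRing k] [Ring H] [HopfAlgebra k H]
    [AddCommGroup M] [Module k M] where
  coact : M →ₗ[k] M ⊗[k] H
  coassoc : (TensorProduct.assoc k M H H).toLinearMap ∘ₗ coact.rTensor H ∘ₗ coact =
    (Coalgebra.comul (R := k) (A := H)).lTensor M ∘ₗ coact
  counit : (TensorProduct.rid k M).toLinearMap ∘ₗ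
    (Coalgebra.counit (R := k) (A := H)).lTensor M ∘ₗ coact = LinearMap.id

/-- A right `H`-comodule algebra: an algebra and right `H`-comodule `A` such that
`ρ : A → A ⊗ H` is a homomorphism of algebras. -/
class HComoduleAlgebra (k H A : Type*) [CommRing k] [Ring H] [HopfAlgebra k H]
    [Ring A] [Algebra k A] extends HComodule k H A where
  coact_one : coact (1 : A) = 1 ⊗ₜ[k] (1 : H)
  coact_mul : ∀ a b : A, coact (a * b) = coact a * coact b

open HComodule (coact)

section Actions

variable (k H : Type*) [CommRing k] [Ring H] [HopfAlgebra k H]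
variable (A M : Type*) [Ring A] [Algebra k A] [AddCommGroup M] [Module k M]

/-- The left action `(a ⊗ h)(m ⊗ h') = a m ⊗ h h'`. -/
def tensorLeftAct [Module A M] [IsScalarTower k A M] :
    A ⊗[k] H →ₗ[k] M ⊗[k] H →ₗ[k] M ⊗[k] H :=
  TensorProduct.map₂ (Algebra.lsmul k k M : A →ₐ[k] _).toLinearMap (LinearMap.mul k H)

/-- The right action, `(m ⊗ h')(a ⊗ h) = m a ⊗ h' h`; the first argument is `a ⊗ h`. -/
def tensorRightAct [Module Aᵐᵒᵖ M] [IsScalarTower k Aᵐᵒᵖ M] :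
    A ⊗[k] H →ₗ[k] M ⊗[k] H →ₗ[k] M ⊗[k] H :=
  TensorProduct.map₂
    ((Algebra.lsmul k k M : Aᵐᵒᵖ →ₐ[k] _).toLinearMap ∘ₗ (opLinearEquiv k).toLinearMap)
    (LinearMap.mul k H).flip

/-- `M` is a left relative Hopf module: `ρ(a m) = a₀ m₀ ⊗ a₁ m₁`. -/
class IsLeftRelHopf [HComoduleAlgebra k H A] [HComodule k H M] [Module A M]
    [IsScalarTower k A M] : Prop where
  coact_smul : ∀ (a : A) (m : M),
    coact (k := k) (H := H) (a • m) = tensorLeftAct k H A M (coact a) (coact m)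

/-- `M` is a right relative Hopf module: `ρ(m a) = m₀ a₀ ⊗ m₁ a₁`. -/
class IsRightRelHopf [HComoduleAlgebra k H A] [HComodule k H M] [Module Aᵐᵒᵖ M]
    [IsScalarTower k Aᵐᵒᵖ M] : Prop where
  coact_op_smul : ∀ (a : A) (m : M),
    coact (k := k) (H := H) (op a • m) = tensorRightAct k H A M (coact a) (coact m)

end Actions

/-! ### Coinvariants -/

section Coinvariants

variable (k H : Type*) [CommRing k] [Ring H] [HopfAlgebra k H]
variable (A B M : Type*) [Ring A] [Algebra k A] [HComoduleAlgebra k H A]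
  [Ring B] [Algebra k B] [HComoduleAlgebra k H B]
  [AddCommGroup M] [Module k M] [HComodule k H M]

/-- The coinvariants `M^{co H} = {m | ρ(m) = m ⊗ 1}`. -/
def coinv : Submodule k M where
  carrier := {m | coact (k := k) (H := H) m = m ⊗ₜ[k] (1 : H)}
  add_mem' {a b} ha hb := by
    simp only [Set.mem_ofPred_eq] at *
    rw [map_add, ha, hb, add_tmul]
  zero_mem' := by simp
  smul_mem' c a ha := by
    simp only [Set.mem_ofPred_eq] at *
    rw [map_smul, ha, smul_tmul']

/-- The algebra of coinvariants `A^{co H}`. -/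
def coinvAlg : Subalgebra k A where
  carrier := {a | coact (k := k) (H := H) a = a ⊗ₜ[k] (1 : H)}
  add_mem' {a b} ha hb := (coinv k H A).add_mem ha hb
  mul_mem' {a b} ha hb := by
    simp only [Set.mem_ofPred_eq] at *
    rw [HComoduleAlgebra.coact_mul, ha, hb, Algebra.TensorProduct.tmul_mul_tmul, mul_one]
  algebraMap_mem' c := by
    simp only [Set.mem_ofPred_eq]
    rw [Algebra.algebraMap_eq_smul_one, map_smul, HComoduleAlgebra.coact_one, smul_tmul']

variable {k H A B M}

theorem mem_coinv {m : M} : m ∈ coinv k H M ↔ coact (k := k) (H := H) m = m ⊗ₜ[k] (1 : H) :=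
  Iff.rfl

theorem coact_coinvAlg (a : coinvAlg k H A) :
    coact (k := k) (H := H) (a : A) = (a : A) ⊗ₜ[k] (1 : H) := a.2

variable [Module A M] [IsScalarTower k A M] [IsLeftRelHopf k H A M]
  [Module Bᵐᵒᵖ M] [IsScalarTower k Bᵐᵒᵖ M] [IsRightRelHopf k H B M]

/-- `M^{co H}` is a left `A^{co H}`-module. -/
instance coinvLeftModule : Module (coinvAlg k H A) (coinv k H M) where
  smul a m := ⟨(a : A) • (m : M), by
    rw [mem_coinv, IsLeftRelHopf.coact_smul, coact_coinvAlg, mem_coinv.1 m.2]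
    simp [tensorLeftAct]⟩
  one_smul m := Subtype.ext (one_smul A (m : M))
  mul_smul a b m := Subtype.ext (mul_smul (a : A) (b : A) (m : M))
  smul_zero a := Subtype.ext (smul_zero (a : A))
  smul_add a m n := Subtype.ext (smul_add (a : A) (m : M) (n : M))
  add_smul a b m := Subtype.ext (add_smul (a : A) (b : A) (m : M))
  zero_smul m := Subtype.ext (zero_smul A (m : M))

/-- `M^{co H}` is a right `B^{co H}`-module. -/
instance coinvRightModule : Module (coinvAlg k H B)ᵐᵒᵖ (coinv k H M) where
  smul b m := ⟨op (b.unop : B) • (m : M), by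
    rw [mem_coinv, IsRightRelHopf.coact_op_smul, coact_coinvAlg, mem_coinv.1 m.2]
    simp [tensorRightAct]⟩
  one_smul m := Subtype.ext (one_smul Bᵐᵒᵖ (m : M))
  mul_smul a b m := Subtype.ext (mul_smul (op (a.unop : B)) (op (b.unop : B)) (m : M))
  smul_zero a := Subtype.ext (smul_zero (op (a.unop : B)))
  smul_add a m n := Subtype.ext (smul_add (op (a.unop : B)) (m : M) (n : M))
  add_smul a b m := Subtype.ext (add_smul (op (a.unop : B)) (op (b.unop : B)) (m : M))
  zero_smul m := Subtype.ext (zero_smul Bᵐᵒᵖ (m : M))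

theorem coe_smul_coinv (a : coinvAlg k H A) (m : coinv k H M) :
    ((a • m : coinv k H M) : M) = (a : A) • (m : M) := rfl

theorem coe_op_smul_coinv (b : coinvAlg k H B) (m : coinv k H M) :
    ((op b • m : coinv k H M) : M) = op (b : B) • (m : M) := rfl

instance : IsScalarTower k (coinvAlg k H A) (coinv k H M) where
  smul_assoc c a m := Subtype.ext (smul_assoc c (a : A) (m : M))

instance : IsScalarTower k (coinvAlg k H B)ᵐᵒᵖ (coinv k H M) where
  smul_assoc c b m := Subtype.ext (smul_assoc c (op (b.unop : B)) (m : M))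

instance [SMulCommClass A Bᵐᵒᵖ M] :
    SMulCommClass (coinvAlg k H A) (coinvAlg k H B)ᵐᵒᵖ (coinv k H M) where
  smul_comm a b m := Subtype.ext (smul_comm (a : A) (op (b.unop : B)) (m : M))

end Coinvariants

/-! ### Faithfully flat Hopf-Galois extensions -/

section Galois

variable (k H A : Type*) [CommRing k] [Ring H] [HopfAlgebra k H]
  [Ring A] [Algebra k A] [HComoduleAlgebra k H A]

/-- `can : A ⊗_{A^{co H}} A → A ⊗ H`, `a ⊗ b ↦ a b₀ ⊗ b₁`. -/
def can : BalTensor k (coinvAlg k H A) A A →ₗ[k] A ⊗[k] H :=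
  BalTensor.lift
    (LinearMap.mul' k (A ⊗[k] H) ∘ₗ TensorProduct.map
      (Algebra.TensorProduct.includeLeft : A →ₐ[k] A ⊗[k] H).toLinearMap coact)
    (fun a c b => by
      simp [subalgebra_op_smul, Subalgebra.smul_def, HComoduleAlgebra.coact_mul, coact_coinvAlg,
        ← mul_assoc])

/-- `can' : A ⊗_{A^{co H}} A → A ⊗ H`, `a ⊗ b ↦ a₀ b ⊗ a₁`. -/
def can' : BalTensor k (coinvAlg k H A) A A →ₗ[k] A ⊗[k] H :=
  BalTensor.lift
    (LinearMap.mul' k (A ⊗[k] H) ∘ₗ TensorProduct.map coact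
      (Algebra.TensorProduct.includeLeft : A →ₐ[k] A ⊗[k] H).toLinearMap)
    (fun a c b => by
      simp [subalgebra_op_smul, Subalgebra.smul_def, HComoduleAlgebra.coact_mul, coact_coinvAlg,
        mul_assoc])

variable {k H A} in
@[simp] theorem can_mk (a b : A) :
    can k H A (BalTensor.mk k (coinvAlg k H A) a b) = (a ⊗ₜ[k] (1 : H)) * coact b := by
  simp [can]

variable {k H A} in
@[simp] theorem can'_mk (a b : A) :
    can' k H A (BalTensor.mk k (coinvAlg k H A) a b) = coact a * (b ⊗ₜ[k] (1 : H)) := by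
  simp [can']

/-- `A` is a right faithfully flat `H`-Galois extension (of `A^{co H}`): `can'` is an isomorphism
and `A` is faithfully flat as a right `A^{co H}`-module. -/
structure IsRightFFGalois : Prop where
  can'_bijective : Function.Bijective (can' k H A)
  faithfullyFlat : IsRightFaithfullyFlat k (coinvAlg k H A) A

end Galois

section Gamma

variable {k H A : Type*} [CommRing k] [Ring H] [HopfAlgebra k H]
  [Ring A] [Algebra k A] [HComoduleAlgebra k H A]

/-- The map `A ⊗ H → A ⊗ H`, `a ⊗ h ↦ a₀ ⊗ a₁ S(h)`. -/
def twist (k H A : Type*) [CommRing k] [Ring H] [HopfAlgebra k H]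
    [Ring A] [Algebra k A] [HComoduleAlgebra k H A] : A ⊗[k] H →ₗ[k] A ⊗[k] H :=
  LinearMap.mul' k (A ⊗[k] H) ∘ₗ TensorProduct.map coact
    ((Algebra.TensorProduct.includeRight : H →ₐ[k] A ⊗[k] H).toLinearMap ∘ₗ
      HopfAlgebra.antipode k)

theorem twist_tmul (a : A) (h : H) :
    twist k H A (a ⊗ₜ[k] h) = coact a * ((1 : A) ⊗ₜ[k] HopfAlgebra.antipode k h) := by
  simp [twist]

/-- If `p(u₁, u₂) = ε(u) q` for all `u`, then `a₀ ⊗ p(a₁, a₂) = a ⊗ q`. -/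
theorem coact_collapse (p : H →ₗ[k] H →ₗ[k] H) (q : H)
    (hp : ∀ u : H, TensorProduct.lift p (Coalgebra.comul (R := k) u) =
      Coalgebra.counit (R := k) u • q) (a : A) :
    (TensorProduct.lift p).lTensor A (TensorProduct.assoc k A H H
      ((coact (k := k) (H := H)).rTensor H (coact a))) = a ⊗ₜ[k] q := by
  have h1 := LinearMap.congr_fun (HComodule.coassoc (k := k) (H := H) (M := A)) a
  have h2 := LinearMap.congr_fun (HComodule.counit (k := k) (H := H) (M := A)) a
  simp only [LinearMap.comp_apply, LinearEquiv.coe_coe, LinearMap.id_apply] at h1 h2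
  rw [h1]
  have key : ∀ x : A ⊗[k] H, (TensorProduct.lift p).lTensor A
      ((Coalgebra.comul (R := k) (A := H)).lTensor A x) =
      (TensorProduct.rid k A ((Coalgebra.counit (R := k) (A := H)).lTensor A x)) ⊗ₜ[k] q := by
    intro x
    induction x with
    | zero => simp
    | tmul a u => simp [hp, smul_tmul]
    | add x y hx hy => simp only [map_add, hx, hy, add_tmul]
  rw [key, h2]

/-- If the antipode is bijective then so is `a ⊗ h ↦ a₀ ⊗ a₁ S(h)`; the inverse is
`a ⊗ h ↦ a₀ ⊗ S⁻¹(h) a₁`. -/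
theorem twist_bijective
    (hS : Function.Bijective (HopfAlgebra.antipode k : H →ₗ[k] H)) :
    Function.Bijective (twist k H A) := by
  let e : H ≃ₗ[k] H := LinearEquiv.ofBijective (HopfAlgebra.antipode k) hS
  have he : ∀ h, HopfAlgebra.antipode k (e.symm h) = h := fun h => e.apply_symm_apply h
  have he' : ∀ h, e.symm (HopfAlgebra.antipode k h) = h := fun h => e.symm_apply_apply h
  let psi : A ⊗[k] H →ₗ[k] A ⊗[k] H :=
    TensorProduct.lift ((LinearMap.mul k (A ⊗[k] H)).flip.compl₁₂ coact
      ((Algebra.TensorProduct.includeRight : H →ₐ[k] A ⊗[k] H).toLinearMap ∘ₗ e.symm.toLinearMap))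
  have hpsi : ∀ (a : A) (h : H), psi (a ⊗ₜ h) = ((1 : A) ⊗ₜ[k] e.symm h) * coact a := by
    intro a h
    simp [psi]
  have emul : ∀ u v, e.symm (u * v) = e.symm v * e.symm u := by
    intro u v
    apply e.injective
    change HopfAlgebra.antipode k _ = HopfAlgebra.antipode k _
    rw [HopfAlgebra.antipode_mul_antidistrib, he, he, he]
  have cop : ∀ u : H, TensorProduct.lift ((LinearMap.mul k H).flip.compl₂ e.symm.toLinearMap)
      (Coalgebra.comul (R := k) u) = Coalgebra.counit (R := k) u • (1 : H) := by
    intro u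
    apply e.injective
    have h1 := HopfAlgebra.mul_antipode_rTensor_comul_apply (R := k) u
    have h2 : ∀ x : H ⊗[k] H,
        e (TensorProduct.lift ((LinearMap.mul k H).flip.compl₂ e.symm.toLinearMap) x) =
        LinearMap.mul' k H ((HopfAlgebra.antipode k).rTensor H x) := by
      intro x
      induction x with
      | zero => simp
      | tmul a b =>
        change HopfAlgebra.antipode k _ = _
        simp [HopfAlgebra.antipode_mul_antidistrib, he]
      | add x y hx hy => simp only [map_add, hx, hy]
    rw [h2, h1, Algebra.algebraMap_eq_smul_one, map_smul]
    change _ = _ • HopfAlgebra.antipode k (1 : H)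
    rw [HopfAlgebra.antipode_one]
  have left : ∀ x, psi (twist k H A x) = x := by
    intro x
    induction x with
    | zero => simp
    | add x y hx hy => simp only [map_add, hx, hy]
    | tmul a h =>
      let p : H →ₗ[k] H →ₗ[k] H :=
        (((LinearMap.mul k H).flip.compl₂ e.symm.toLinearMap)).compr₂ (LinearMap.mulLeft k h)
      have hp : ∀ u : H, TensorProduct.lift p (Coalgebra.comul (R := k) u) =
          Coalgebra.counit (R := k) u • h := by
        intro u
        rw [TensorProduct.lift_compr₂, LinearMap.comp_apply, cop]
        simp
      rw [twist_tmul, ← coact_collapse p h hp a]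
      generalize (coact a : A ⊗[k] H) = x
      induction x with
      | zero => simp
      | add x y hx hy => simp only [map_add, add_mul, hx, hy]
      | tmul b u =>
        rw [Algebra.TensorProduct.tmul_mul_tmul, mul_one, hpsi, emul, he',
          LinearMap.rTensor_tmul]
        generalize (coact b : A ⊗[k] H) = y
        induction y with
        | zero => simp
        | add x y hx hy => simp only [map_add, add_tmul, mul_add, hx, hy]
        | tmul c v => simp [p, mul_assoc]
  have right : ∀ x, twist k H A (psi x) = x := by
    intro x
    induction x with
    | zero => simp
    | add x y hx hy => simp only [map_add, hx, hy]
    | tmul a h =>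
      let p : H →ₗ[k] H →ₗ[k] H :=
        (((LinearMap.mul k H).compl₂ (HopfAlgebra.antipode k))).compr₂ (LinearMap.mulRight k h)
      have hp : ∀ u : H, TensorProduct.lift p (Coalgebra.comul (R := k) u) =
          Coalgebra.counit (R := k) u • h := by
        intro u
        have h1 := HopfAlgebra.mul_antipode_lTensor_comul_apply (R := k) u
        have h2 : ∀ x : H ⊗[k] H, TensorProduct.lift p x =
            LinearMap.mul' k H ((HopfAlgebra.antipode k).lTensor H x) * h := by
          intro x
          induction x with
          | zero => simp
          | tmul a b => simp [p]
          | add x y hx hy => simp only [map_add, add_mul, hx, hy]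
        rw [h2, h1, Algebra.algebraMap_eq_smul_one, smul_mul_assoc, one_mul]
      rw [hpsi, ← coact_collapse p h hp a]
      generalize (coact a : A ⊗[k] H) = x
      induction x with
      | zero => simp
      | add x y hx hy => simp only [map_add, mul_add, hx, hy]
      | tmul b u =>
        rw [Algebra.TensorProduct.tmul_mul_tmul, one_mul, twist_tmul,
          HopfAlgebra.antipode_mul_antidistrib, he, LinearMap.rTensor_tmul]
        generalize (coact b : A ⊗[k] H) = y
        induction y with
        | zero => simp
        | add x y hx hy => simp only [map_add, add_tmul, add_mul, hx, hy]
        | tmul c v => simp [p, mul_assoc]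
  exact Function.bijective_iff_has_inverse.2 ⟨psi, left, right⟩

theorem twist_can (z : BalTensor k (coinvAlg k H A) A A) :
    twist k H A (can k H A z) = can' k H A z := by
  have hmul : ∀ (a : A) (x : A ⊗[k] H), twist k H A ((a ⊗ₜ[k] (1 : H)) * x) =
      coact a * twist k H A x := by
    intro a x
    induction x with
    | zero => simp
    | add x y hx hy => simp only [map_add, mul_add, hx, hy]
    | tmul b u =>
      rw [Algebra.TensorProduct.tmul_mul_tmul, one_mul, twist_tmul, twist_tmul,
        HComoduleAlgebra.coact_mul, mul_assoc]
  have hco : ∀ b : A, twist k H A (coact b) = b ⊗ₜ[k] (1 : H) := by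
    intro b
    have hp : ∀ u : H, TensorProduct.lift ((LinearMap.mul k H).compl₂ (HopfAlgebra.antipode k))
        (Coalgebra.comul (R := k) u) = Coalgebra.counit (R := k) u • (1 : H) := by
      intro u
      have h1 := HopfAlgebra.mul_antipode_lTensor_comul_apply (R := k) u
      have h2 : ∀ x : H ⊗[k] H,
          TensorProduct.lift ((LinearMap.mul k H).compl₂ (HopfAlgebra.antipode k)) x =
          LinearMap.mul' k H ((HopfAlgebra.antipode k).lTensor H x) := by
        intro x
        induction x with
        | zero => simp
        | tmul a b => simp
        | add x y hx hy => simp only [map_add, hx, hy]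
      rw [h2, h1, Algebra.algebraMap_eq_smul_one]
    rw [← coact_collapse _ _ hp b]
    generalize (coact b : A ⊗[k] H) = x
    induction x with
    | zero => simp
    | add x y hx hy => simp only [map_add, hx, hy]
    | tmul b u =>
      rw [twist_tmul, LinearMap.rTensor_tmul]
      generalize (coact b : A ⊗[k] H) = y
      induction y with
      | zero => simp
      | add x y hx hy => simp only [map_add, add_tmul, add_mul, hx, hy]
      | tmul c v => simp
  induction z using BalTensor.induction with
  | zero => simp
  | add x y hx hy => simp only [map_add, hx, hy]
  | tmul a b => rw [can_mk, can'_mk, hmul, hco]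

/-- If the antipode is bijective, then `can` is bijective as soon as `can'` is. -/
theorem IsRightFFGalois.can_bijective
    (hS : Function.Bijective (HopfAlgebra.antipode k : H →ₗ[k] H))
    (hA : IsRightFFGalois k H A) : Function.Bijective (can k H A) := by
  have h : can' k H A = twist k H A ∘ₗ can k H A := LinearMap.ext fun z => (twist_can z).symm
  have h2 := hA.can'_bijective
  rw [h, LinearMap.coe_comp] at h2
  exact (Function.Bijective.of_comp_iff' (twist_bijective hS) _).1 h2

end Gamma

/-! ### The Miyashita-Ulbrich action -/

section MiyashitaUlbrich

variable {k H A : Type*} [CommRing k] [Ring H] [HopfAlgebra k H]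
  [Ring A] [Algebra k A] [HComoduleAlgebra k H A]

/-- `γ_A(h) = can⁻¹(1 ⊗ h) = ∑ lᵢ(h) ⊗ rᵢ(h)`. -/
noncomputable def gamma (hS : Function.Bijective (HopfAlgebra.antipode k : H →ₗ[k] H))
    (hA : IsRightFFGalois k H A) : H →ₗ[k] BalTensor k (coinvAlg k H A) A A :=
  (LinearEquiv.ofBijective (can k H A) (hA.can_bijective hS)).symm.toLinearMap ∘ₗ
    (Algebra.TensorProduct.includeRight : H →ₐ[k] A ⊗[k] H).toLinearMap

theorem can_gamma (hS : Function.Bijective (HopfAlgebra.antipode k : H →ₗ[k] H))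
    (hA : IsRightFFGalois k H A) (h : H) : can k H A (gamma hS hA h) = (1 : A) ⊗ₜ[k] h :=
  (LinearEquiv.ofBijective (can k H A) (hA.can_bijective hS)).apply_symm_apply _

/-- Left multiplication by `a` on `A ⊗_{A^{co H}} A`. -/
def balLeftMul (a : A) : BalTensor k (coinvAlg k H A) A A →ₗ[k] BalTensor k (coinvAlg k H A) A A :=
  BalTensor.lift
    (TensorProduct.lift ((BalTensor.mk k _).compl₁₂ (LinearMap.mulLeft k a) LinearMap.id))
    (fun x c y => by
      simp [subalgebra_op_smul, ← mul_assoc, ← BalTensor.mk_smul])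

/-- Right multiplication by `a` on `A ⊗_{A^{co H}} A`. -/
def balRightMul (a : A) :
    BalTensor k (coinvAlg k H A) A A →ₗ[k] BalTensor k (coinvAlg k H A) A A :=
  BalTensor.lift
    (TensorProduct.lift ((BalTensor.mk k _).compl₁₂ LinearMap.id (LinearMap.mulRight k a)))
    (fun x c y => by
      simp [BalTensor.mk_smul, smul_mul_assoc])

/-- `γ_A(h)` is centralized by `A^{co H}`. -/
theorem gamma_central (hS : Function.Bijective (HopfAlgebra.antipode k : H →ₗ[k] H))
    (hA : IsRightFFGalois k H A) (h : H) (c : coinvAlg k H A) :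
    balLeftMul (c : A) (gamma hS hA h) = balRightMul (c : A) (gamma hS hA h) := by
  apply (hA.can_bijective hS).1
  have hl : ∀ z, can k H A (balLeftMul (c : A) z) = ((c : A) ⊗ₜ[k] (1 : H)) * can k H A z := by
    intro z
    induction z using BalTensor.induction with
    | zero => simp
    | add x y hx hy => simp only [map_add, mul_add, hx, hy]
    | tmul a b => simp [balLeftMul, ← mul_assoc]
  have hr : ∀ z, can k H A (balRightMul (c : A) z) = can k H A z * ((c : A) ⊗ₜ[k] (1 : H)) := by
    intro z
    induction z using BalTensor.induction with
    | zero => simp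
    | add x y hx hy => simp only [map_add, add_mul, hx, hy]
    | tmul a b => simp [balRightMul, HComoduleAlgebra.coact_mul, coact_coinvAlg, ← mul_assoc]
  rw [hl, hr, can_gamma]
  simp

/-- A right `A`-module `P` with a right `A^{co H}`-module structure that is the restriction of its
right `A`-module structure. -/
class IsRestrictedCoinv (k H A P : Type*) [CommRing k] [Ring H] [HopfAlgebra k H]
    [Ring A] [Algebra k A] [HComoduleAlgebra k H A] [AddCommGroup P] [Module Aᵐᵒᵖ P]
    [Module (coinvAlg k H A)ᵐᵒᵖ P] : Prop where
  op_smul : ∀ (c : coinvAlg k H A) (p : P), op c • p = op (c : A) • p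

instance {P : Type*} [AddCommGroup P] [Module Aᵐᵒᵖ P] : IsRestrictedCoinv k H A P where
  op_smul _ _ := rfl

variable {P Q : Type*}
  [AddCommGroup P] [Module k P] [Module Aᵐᵒᵖ P] [IsScalarTower k Aᵐᵒᵖ P]
  [Module (coinvAlg k H A)ᵐᵒᵖ P] [IsScalarTower k (coinvAlg k H A)ᵐᵒᵖ P]
  [IsRestrictedCoinv k H A P]
  [AddCommGroup Q] [Module k Q] [Module Aᵐᵒᵖ Q] [IsScalarTower k Aᵐᵒᵖ Q]
  [Module (coinvAlg k H A)ᵐᵒᵖ Q] [IsScalarTower k (coinvAlg k H A)ᵐᵒᵖ Q]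
  [IsRestrictedCoinv k H A Q]

/-- For a right `A^{co H}`-linear `f : P → Q` and `p : P`, the map `A ⊗_{A^{co H}} A → Q`,
`l ⊗ r ↦ f(p l) r`. -/
def sandwich (f : P →ₗ[(coinvAlg k H A)ᵐᵒᵖ] Q) (p : P) :
    BalTensor k (coinvAlg k H A) A A →ₗ[k] Q :=
  BalTensor.lift
    (TensorProduct.lift (LinearMap.mk₂ k (fun l r : A => op r • f (op l • p))
      (fun l l' r => by simp [add_smul])
      (fun c l r => by
        have : f (c • (op l • p)) = c • f (op l • p) := (f.restrictScalars k).map_smul c _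
        rw [op_smul, smul_assoc, this, smul_comm])
      (fun l r r' => by simp [add_smul])
      (fun c l r => by simp)))
    (fun l c r => by
      have h : op (l * (c : A)) • p = op c • (op l • p) := by
        rw [IsRestrictedCoinv.op_smul (k := k) (H := H), op_mul, mul_smul]
      simp only [TensorProduct.lift.tmul, LinearMap.mk₂_apply, subalgebra_op_smul,
        Subalgebra.smul_def, smul_eq_mul, op_smul_eq_mul]
      rw [h, map_smul, IsRestrictedCoinv.op_smul (k := k) (H := H), ← mul_smul, ← op_mul])

theorem sandwich_mk (f : P →ₗ[(coinvAlg k H A)ᵐᵒᵖ] Q) (p : P) (l r : A) :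
    sandwich f p (BalTensor.mk k _ l r) = op r • f (op l • p) := rfl

/-- The Miyashita-Ulbrich action of `H` on `Hom_{A^{co H}}(P, Q)`, for right `A`-modules `P` and
`Q`: `(f ↼ h)(p) = ∑ f(p lᵢ(h)) rᵢ(h)`, where `γ_A(h) = ∑ lᵢ(h) ⊗ rᵢ(h)`. -/
noncomputable def miyashitaUlbrich
    (hS : Function.Bijective (HopfAlgebra.antipode k : H →ₗ[k] H))
    (hA : IsRightFFGalois k H A) (f : P →ₗ[(coinvAlg k H A)ᵐᵒᵖ] Q) (h : H) :
    P →ₗ[(coinvAlg k H A)ᵐᵒᵖ] Q where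
  toFun p := sandwich f p (gamma hS hA h)
  map_add' p p' := by
    rw [← LinearMap.add_apply]
    congr 1
    exact BalTensor.ext fun l r => by simp [sandwich_mk]
  map_smul' c p := by
    obtain ⟨c, rfl⟩ := op_surjective c
    have h1 : ∀ z, sandwich f (op c • p) z = sandwich f p (balLeftMul (c : A) z) := by
      intro z
      induction z using BalTensor.induction with
      | zero => simp
      | add x y hx hy => simp only [map_add, hx, hy]
      | tmul l r =>
        simp [balLeftMul, sandwich_mk, IsRestrictedCoinv.op_smul (k := k) (H := H), mul_smul]
    have h2 : ∀ z, sandwich f p (balRightMul (c : A) z) = op c • sandwich f p z := by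
      intro z
      induction z using BalTensor.induction with
      | zero => simp
      | add x y hx hy => simp only [map_add, smul_add, hx, hy]
      | tmul l r =>
        simp [balRightMul, sandwich_mk, IsRestrictedCoinv.op_smul (k := k) (H := H), mul_smul]
    rw [RingHom.id_apply, h1, gamma_central, h2]

end MiyashitaUlbrich

/-! ### `H`-Morita contexts -/

section Morita

variable (k H A B M N : Type*) [CommRing k] [Ring H] [HopfAlgebra k H]
  [Ring A] [Algebra k A] [HComoduleAlgebra k H A]
  [Ring B] [Algebra k B] [HComoduleAlgebra k H B]

/-- The coaction `ρ(m ⊗_B n) = m₀ ⊗_B n₀ ⊗ m₁ n₁` on `M ⊗_B N`. -/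
def balCoact
    [AddCommGroup M] [Module k M] [HComodule k H M]
    [Module Bᵐᵒᵖ M] [IsScalarTower k Bᵐᵒᵖ M] [IsRightRelHopf k H B M]
    [AddCommGroup N] [Module k N] [HComodule k H N]
    [Module B N] [IsScalarTower k B N] [IsLeftRelHopf k H B N] :
    BalTensor k B M N →ₗ[k] BalTensor k B M N ⊗[k] H :=
  BalTensor.lift
    (TensorProduct.lift
      ((TensorProduct.map₂ (BalTensor.mk k B) (LinearMap.mul k H)).compl₁₂
        (coact (k := k) (H := H) (M := M)) (coact (k := k) (H := H) (M := N))))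
    (fun m b n => by
      simp only [TensorProduct.lift.tmul, LinearMap.compl₁₂_apply,
        IsLeftRelHopf.coact_smul, IsRightRelHopf.coact_op_smul]
      generalize (coact m : M ⊗[k] H) = x
      generalize (coact n : N ⊗[k] H) = y
      generalize (coact b : B ⊗[k] H) = z
      induction z with
      | zero => simp
      | add z z' hz hz' => simp only [map_add, LinearMap.add_apply, hz, hz']
      | tmul b g =>
        induction x with
        | zero => simp
        | add x x' hx hx' => simp only [map_add, LinearMap.add_apply, hx, hx']
        | tmul m g' =>
          induction y with
          | zero => simp
          | add y y' hy hy' => simp only [map_add, hy, hy']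
          | tmul n g'' =>
            simp [tensorLeftAct, tensorRightAct, BalTensor.mk_smul, mul_assoc])

variable
  [AddCommGroup M] [Module k M] [HComodule k H M]
  [Module A M] [IsScalarTower k A M] [Module Bᵐᵒᵖ M] [IsScalarTower k Bᵐᵒᵖ M]
  [SMulCommClass A Bᵐᵒᵖ M] [IsLeftRelHopf k H A M] [IsRightRelHopf k H B M]
  [AddCommGroup N] [Module k N] [HComodule k H N]
  [Module B N] [IsScalarTower k B N] [Module Aᵐᵒᵖ N] [IsScalarTower k Aᵐᵒᵖ N]
  [SMulCommClass B Aᵐᵒᵖ N] [IsLeftRelHopf k H B N] [IsRightRelHopf k H A N]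

/-- An `H`-Morita context `(A, B, M, N, α, β)`: two-sided relative Hopf modules `M` (over `A`, `B`)
and `N` (over `B`, `A`), and bilinear `H`-colinear maps `α : M ⊗_B N → A` and `β : N ⊗_A M → B`
with `α(m ⊗ n) m' = m β(n ⊗ m')` and `β(n ⊗ m) n' = n α(m ⊗ n')`. -/
structure HMoritaContext where
  α : BalTensor k B M N →ₗ[k] A
  α_left : ∀ (a : A) (m : M) (n : N),
    α (BalTensor.mk k B (a • m) n) = a * α (BalTensor.mk k B m n)
  α_right : ∀ (m : M) (n : N) (a : A),
    α (BalTensor.mk k B m (op a • n)) = α (BalTensor.mk k B m n) * a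
  α_colinear : ∀ t, coact (α t) = α.rTensor H (balCoact k H B M N t)
  β : BalTensor k A N M →ₗ[k] B
  β_left : ∀ (b : B) (n : N) (m : M),
    β (BalTensor.mk k A (b • n) m) = b * β (BalTensor.mk k A n m)
  β_right : ∀ (n : N) (m : M) (b : B),
    β (BalTensor.mk k A n (op b • m)) = β (BalTensor.mk k A n m) * b
  β_colinear : ∀ t, coact (β t) = β.rTensor H (balCoact k H A N M t)
  α_smul : ∀ (m : M) (n : N) (m' : M),
    α (BalTensor.mk k B m n) • m' = op (β (BalTensor.mk k A n m')) • m
  β_smul : ∀ (n : N) (m : M) (n' : N),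
    β (BalTensor.mk k A n m) • n' = op (α (BalTensor.mk k B m n')) • n

variable {k H A B M N} in
/-- The context is strict if `α` and `β` are isomorphisms. -/
def HMoritaContext.IsStrict (c : HMoritaContext k H A B M N) : Prop :=
  Function.Bijective c.α ∧ Function.Bijective c.β

end Morita

/-! ### The map `f ↦ f ⊗ M^{co H}` and the transported action -/

section HomMap

variable {k H A B M : Type*} [CommRing k] [Ring H] [HopfAlgebra k H]
  [Ring A] [Algebra k A] [HComoduleAlgebra k H A]
  [Ring B] [Algebra k B] [HComoduleAlgebra k H B]
  [AddCommGroup M] [Module k M] [HComodule k H M]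
  [Module A M] [IsScalarTower k A M] [Module Bᵐᵒᵖ M] [IsScalarTower k Bᵐᵒᵖ M]
  [SMulCommClass A Bᵐᵒᵖ M] [IsLeftRelHopf k H A M] [IsRightRelHopf k H B M]
variable {X Y : Type*}
  [AddCommGroup X] [Module k X] [Module Aᵐᵒᵖ X] [IsScalarTower k Aᵐᵒᵖ X]
  [AddCommGroup Y] [Module k Y] [Module Aᵐᵒᵖ Y] [IsScalarTower k Aᵐᵒᵖ Y]

variable (k H A M X) in
/-- `X ⊗_{A^{co H}} M^{co H}`. -/
abbrev CoinvTensor : Type _ := BalTensor k (coinvAlg k H A) X (coinv k H M)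

variable (k H A M X) in
/-- The map `X ⊗_{A^{co H}} M^{co H} → X ⊗_A M`, `x ⊗ m ↦ x ⊗ m`. -/
def coinvTensorMap : CoinvTensor k H A M X →ₗ[k] BalTensor k A X M :=
  BalTensor.lift
    (TensorProduct.lift ((BalTensor.mk k A).compl₁₂ LinearMap.id (coinv k H M).subtype))
    (fun x c m => by
      simp [subalgebra_op_smul, BalTensor.mk_smul, coe_smul_coinv])

theorem coinvTensorMap_mk (x : X) (m : coinv k H M) :
    coinvTensorMap k H A M X (BalTensor.mk k _ x m) = BalTensor.mk k A x (m : M) := rfl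

variable (k H A B M X Y) in
/-- The map `Hom_{A^{co H}}(X, Y) → Hom_{B^{co H}}(X ⊗_{A^{co H}} M^{co H}, Y ⊗_{A^{co H}} M^{co H})`,
`f ↦ f ⊗ M^{co H}`. -/
def homTensorCoinv : (X →ₗ[(coinvAlg k H A)ᵐᵒᵖ] Y) →ₗ[k]
    (CoinvTensor k H A M X →ₗ[(coinvAlg k H B)ᵐᵒᵖ] CoinvTensor k H A M Y) where
  toFun f :=
    { BalTensor.map f LinearMap.id with
      map_smul' := fun b z => by
        change BalTensor.map f LinearMap.id (b • z) = b • BalTensor.map f LinearMap.id z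
        induction z using BalTensor.induction with
        | zero => simp
        | add x y hx hy => simp only [map_add, smul_add, hx, hy]
        | tmul x m => simp [BalTensor.smul_mk] }
  map_add' f g := by
    ext z
    change BalTensor.map (k := k) (f + g) LinearMap.id z =
      (BalTensor.map f LinearMap.id + BalTensor.map g LinearMap.id :
        CoinvTensor k H A M X →ₗ[k] CoinvTensor k H A M Y) z
    congr 1
    exact BalTensor.ext fun x m => by simp
  map_smul' c f := by
    ext z
    change BalTensor.map (k := k) (c • f) LinearMap.id z =
      (c • BalTensor.map f LinearMap.id : CoinvTensor k H A M X →ₗ[k] CoinvTensor k H A M Y) z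
    congr 1
    exact BalTensor.ext fun x m => by simp

theorem homTensorCoinv_mk (f : X →ₗ[(coinvAlg k H A)ᵐᵒᵖ] Y) (x : X) (m : coinv k H M) :
    homTensorCoinv k H A B M X Y f (BalTensor.mk k _ x m) = BalTensor.mk k _ (f x) m := rfl

/-- The right `B`-module structure on `X ⊗_{A^{co H}} M^{co H}` that is transported from
`X ⊗_A M`, where `(x ⊗ m) b = x ⊗ m b`, along the bijection `x ⊗ m ↦ x ⊗ m`. -/
noncomputable abbrev transportedModule (hX : Function.Bijective (coinvTensorMap k H A M X)) :
    Module Bᵐᵒᵖ (CoinvTensor k H A M X) :=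
  letI : SMul Bᵐᵒᵖ (CoinvTensor k H A M X) :=
    ⟨fun b z => (Equiv.ofBijective _ hX).symm (b • coinvTensorMap k H A M X z)⟩
  Function.Injective.module Bᵐᵒᵖ (coinvTensorMap k H A M X).toAddMonoidHom hX.1
    (fun b z => (Equiv.ofBijective _ hX).apply_symm_apply (b • coinvTensorMap k H A M X z))

theorem coinvTensorMap_transported (hX : Function.Bijective (coinvTensorMap k H A M X))
    (b : Bᵐᵒᵖ) (z : CoinvTensor k H A M X) :
    letI := transportedModule (B := B) hX
    coinvTensorMap k H A M X (b • z) = b • coinvTensorMap k H A M X z :=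
  (Equiv.ofBijective _ hX).apply_symm_apply (b • coinvTensorMap k H A M X z)

theorem transportedModule_tower (hX : Function.Bijective (coinvTensorMap k H A M X)) :
    letI := transportedModule (B := B) hX
    IsScalarTower k Bᵐᵒᵖ (CoinvTensor k H A M X) :=
  letI := transportedModule (B := B) hX
  ⟨fun c b z => hX.1 (by
    rw [coinvTensorMap_transported, map_smul, coinvTensorMap_transported, smul_assoc])⟩

/-- The transported right `B`-action extends the right `B^{co H}`-action
`(x ⊗ m) b = x ⊗ m b`. -/
theorem transportedModule_restricted (hX : Function.Bijective (coinvTensorMap k H A M X)) :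
    letI := transportedModule (B := B) hX
    @IsRestrictedCoinv k H B (CoinvTensor k H A M X) _ _ _ _ _ _ _ _ BalTensor.rightModule :=
  letI := transportedModule (B := B) hX
  ⟨fun c z => hX.1 (by
    rw [coinvTensorMap_transported]
    induction z using BalTensor.induction with
    | zero => simp
    | add x y hx hy => simp only [map_add, smul_add, hx, hy]
    | tmul x m => rfl)⟩

/-- The Miyashita-Ulbrich action of `H` on
`Hom_{B^{co H}}(X ⊗_{A^{co H}} M^{co H}, Y ⊗_{A^{co H}} M^{co H})`, with respect to the transported
right `B`-module structures. -/
noncomputable def miyashitaUlbrichTransported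
    (hS : Function.Bijective (HopfAlgebra.antipode k : H →ₗ[k] H)) (hB : IsRightFFGalois k H B)
    (hX : Function.Bijective (coinvTensorMap k H A M X))
    (hY : Function.Bijective (coinvTensorMap k H A M Y))
    (g : CoinvTensor k H A M X →ₗ[(coinvAlg k H B)ᵐᵒᵖ] CoinvTensor k H A M Y) (h : H) :
    CoinvTensor k H A M X →ₗ[(coinvAlg k H B)ᵐᵒᵖ] CoinvTensor k H A M Y :=
  letI := transportedModule (B := B) hX
  letI := transportedModule (B := B) hY
  haveI := transportedModule_tower (B := B) hX
  haveI := transportedModule_tower (B := B) hY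
  haveI := transportedModule_restricted (B := B) hX
  haveI := transportedModule_restricted (B := B) hY
  miyashitaUlbrich hS hB g h

end HomMap

end HMorita

set_option linter.unusedSectionVars false

namespace HMorita

open HComodule (coact)

/-! ### Flatness in all universes -/

section Characters

/-! Write A₀ and B₀ for the coinvariants of A and B, and M₀ and N₀ for those of M and N. Everything
rests on the structure theorem `coinvStructureMap_bijective`: A ⊗_{A₀} M₀ → M, a ⊗ m ↦ am, is
bijective. Indeed M₀ is the equalizer of ρ and m ↦ m ⊗ 1, which the flat functor A ⊗_{A₀} -
preserves. Bijectivity of `can'` compares the resulting diagram with M → M ⊗ H ⇉ M ⊗ H ⊗ H, which is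
an equalizer by coassociativity and counitality. Hence X ⊗_{A₀} M₀ ≅ X ⊗_A A ⊗_{A₀} M₀ ≅ X ⊗_A M.

For the bijectivity of φ, let I be the image of M₀ ⊗ N₀ in A₀ under α. Since M = A M₀ and N = B N₀,
surjectivity of α forces A ⊗_{A₀} (A₀/I) = 0, so I = A₀ by faithfulness. Choose 1 = ∑ α(mᵢ ⊗ nᵢ)
with coinvariant mᵢ, nᵢ. Contracting against the nᵢ recovers f from φ(f), as f(x) = ∑ f(x) α(mᵢ ⊗
nᵢ), and the same formula inverts φ.

For the actions of H, compare both sides on x ⊗ m inside Y ⊗_A M. Each is the image of an element of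
A ⊗_{A₀} M under a ⊗ m ↦ f(xa) ⊗ m. The injective map a ⊗ m ↦ a₀m ⊗ a₁ sends both elements to m ⊗
S(h), because `can'` sends γ_A(h) and γ_B(h) to 1 ⊗ S(h).

The flatness hypothesis only tests modules in the universe of A₀, while M may live elsewhere. The
character module bridges the gap: Baer's criterion only needs left ideals, and injectivity of the
character module then gives flatness in every universe. -/

/-- The character group `P →+ ℚ/ℤ` of a right `R`-module `P`, as a left `R`-module:
`(r χ)(p) = χ(p r)`. -/
def RightCharacter (R P : Type*) [Ring R] [AddCommGroup P] [Module Rᵐᵒᵖ P] : Type _ :=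
  P →+ AddCircle (1 : ℚ)

namespace RightCharacter

variable {R P : Type*} [Ring R] [AddCommGroup P] [Module Rᵐᵒᵖ P]

instance : AddCommGroup (RightCharacter R P) :=
  inferInstanceAs (AddCommGroup (P →+ AddCircle (1 : ℚ)))

instance : FunLike (RightCharacter R P) P (AddCircle (1 : ℚ)) :=
  inferInstanceAs (FunLike (P →+ AddCircle (1 : ℚ)) P _)

instance : AddMonoidHomClass (RightCharacter R P) P (AddCircle (1 : ℚ)) :=
  inferInstanceAs (AddMonoidHomClass (P →+ AddCircle (1 : ℚ)) P _)

theorem ext {χ ψ : RightCharacter R P} (h : ∀ p, χ p = ψ p) : χ = ψ := DFunLike.ext _ _ h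

theorem add_apply (χ ψ : RightCharacter R P) (p : P) : (χ + ψ) p = χ p + ψ p := rfl

instance : Module R (RightCharacter R P) where
  smul r χ := AddMonoidHom.comp χ (DistribSMul.toAddMonoidHom P (op r))
  one_smul χ := ext fun p => congrArg χ (one_smul _ p)
  mul_smul r s χ := ext fun p => congrArg χ (by
    change op (r * s) • p = op s • op r • p
    rw [op_mul, mul_smul])
  smul_zero r := ext fun p => rfl
  smul_add r χ ψ := ext fun p => rfl
  add_smul r s χ := ext fun p => (congrArg χ (add_smul (op r) (op s) p)).trans (map_add χ _ _)
  zero_smul χ := ext fun p => (congrArg χ (zero_smul Rᵐᵒᵖ p)).trans (map_zero χ)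

theorem smul_apply (r : R) (χ : RightCharacter R P) (p : P) : (r • χ) p = χ (op r • p) := rfl

variable {k : Type*} [CommRing k] [Algebra k R] [Module k P] [IsScalarTower k Rᵐᵒᵖ P]
variable {N N' : Type*} [AddCommGroup N] [Module k N] [Module R N] [IsScalarTower k R N]

theorem op_algebraMap_smul (c : k) (p : P) : op (algebraMap k R c) • p = c • p := by
  rw [Algebra.algebraMap_eq_smul_one, op_smul, smul_assoc, op_one, one_smul]

variable (k) in
/-- The character of `P ⊗_R N` that corresponds to an `R`-linear map `N → (P →+ ℚ/ℤ)`. -/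
noncomputable def uncurry (g : N →ₗ[R] RightCharacter R P) :
    CharacterModule (BalTensor k R P N) :=
  let f : P ⊗[k] N →+ AddCircle (1 : ℚ) := TensorProduct.liftAddHom
    (AddMonoidHom.mk' (fun p => AddMonoidHom.mk' (fun n => g n p)
      fun n n' => by rw [map_add, add_apply]) fun p p' => AddMonoidHom.ext fun n => map_add (g n) p p')
    (fun c p n => by
      change g n (c • p) = g (c • n) p
      rw [← algebraMap_smul R c n, g.map_smul, smul_apply, op_algebraMap_smul])
  QuotientAddGroup.lift (balRel k R P N).toAddSubgroup f (by
    intro t ht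
    -- `f` is only additive whereas `balRel` is a `k`-span. Treating all multiples of t at once lets
    -- the span induction pass through scalars.
    have key : ∀ c : k, f (c • t) = 0 := by
      refine Submodule.span_induction (p := fun t _ => ∀ c : k, f (c • t) = 0) ?_ ?_ ?_ ?_ ht
      · rintro _ ⟨p, r, n, rfl⟩ c
        rw [smul_sub, map_sub, sub_eq_zero, smul_tmul', smul_tmul', ← op_algebraMap_smul (R := R),
          ← op_algebraMap_smul (R := R) c p]
        change g n (op (algebraMap k R c) • op r • p) = g (r • n) (op (algebraMap k R c) • p)
        rw [g.map_smul, smul_apply, ← mul_smul, ← mul_smul, ← op_mul, ← op_mul, Algebra.commutes]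
      · intro c
        simp
      · intro x y _ _ hx hy c
        rw [smul_add, map_add, hx, hy, add_zero]
      · intro a x _ hx c
        rw [← mul_smul, hx]
    simpa using key 1)

theorem uncurry_mk (g : N →ₗ[R] RightCharacter R P) (p : P) (n : N) :
    uncurry k g (BalTensor.mk k R p n) = g n p := rfl

/-- The `R`-linear map `N → (P →+ ℚ/ℤ)` that corresponds to a character of `P ⊗_R N`. -/
def curry (χ : CharacterModule (BalTensor k R P N)) : N →ₗ[R] RightCharacter R P where
  toFun n := AddMonoidHom.mk' (fun p => χ (BalTensor.mk k R p n)) fun p p' => by simp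
  map_add' n n' := ext fun p => by
    change χ _ = χ _ + χ _
    simp
  map_smul' r n := ext fun p => by
    exact congrArg χ (BalTensor.mk_smul k R p r n).symm

theorem curry_apply (χ : CharacterModule (BalTensor k R P N)) (n : N) (p : P) :
    curry χ n p = χ (BalTensor.mk k R p n) := rfl

end RightCharacter

variable {k : Type*} {R : Type u} {P : Type*} [CommRing k] [Ring R]
    [Algebra k R] [AddCommGroup P] [Module k P] [Module Rᵐᵒᵖ P] [IsScalarTower k Rᵐᵒᵖ P]

/-- Lambek's argument: a map from a left ideal I to the character module is a character of P ⊗ I.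
Since P ⊗ I embeds in P ⊗ R and ℚ/ℤ is injective, this character extends. -/
theorem IsRightFaithfullyFlat.baer (hP : IsRightFaithfullyFlat k R P) :
    Module.Baer R (RightCharacter R P) := by
  intro I g
  obtain ⟨χ, hχ⟩ := CharacterModule.dual_surjective_of_injective _
    (hP.flat I R (Submodule.subtype I) Subtype.val_injective) (RightCharacter.uncurry k g)
  refine ⟨RightCharacter.curry χ, fun x hx => RightCharacter.ext fun p => ?_⟩
  rw [RightCharacter.curry_apply]
  exact DFunLike.congr_fun hχ (BalTensor.mk k R p ⟨x, hx⟩)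

/-- Every character χ of P ⊗ N factors through P ⊗ N', because its curried form extends along f by
injectivity of the character module. So an element of the kernel is killed by all characters. Here N
and N' lie in arbitrary universes. -/
theorem IsRightFaithfullyFlat.map_injective (hP : IsRightFaithfullyFlat k R P)
    {N N' : Type*} [AddCommGroup N] [Module k N] [Module R N] [IsScalarTower k R N]
    [AddCommGroup N'] [Module k N'] [Module R N'] [IsScalarTower k R N'] (f : N →ₗ[R] N')
    (hf : Function.Injective f) :
    Function.Injective (BalTensor.map (k := k) (LinearMap.id : P →ₗ[Rᵐᵒᵖ] P) f) := by
  rw [← LinearMap.ker_eq_bot, LinearMap.ker_eq_bot']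
  intro z hz
  refine CharacterModule.eq_zero_of_character_apply fun χ => ?_
  obtain ⟨g, hg⟩ := Module.Baer.extension_property hP.baer f hf (RightCharacter.curry χ)
  have key : ∀ z, χ z = RightCharacter.uncurry k g (BalTensor.map LinearMap.id f z) := by
    intro z
    induction z using BalTensor.induction with
    | zero => simp
    | add x y hx hy => simp only [map_add, hx, hy]
    | tmul p n =>
      rw [BalTensor.map_mk, RightCharacter.uncurry_mk, LinearMap.id_apply,
        ← LinearMap.comp_apply, hg, RightCharacter.curry_apply]
  rw [key, hz, map_zero]

end Characters

/-! ### Exactness of P ⊗_R - -/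

section Kernel

variable {k R P : Type*} [CommRing k] [Ring R]
    [Algebra k R] [AddCommGroup P] [Module k P] [Module Rᵐᵒᵖ P] [IsScalarTower k Rᵐᵒᵖ P]
variable {N N' : Type*} [AddCommGroup N] [Module k N] [Module R N] [IsScalarTower k R N]
    [AddCommGroup N'] [Module k N'] [Module R N'] [IsScalarTower k R N']

/-- Right exactness: an element of `P ⊗_R N` that vanishes in `P ⊗_R N/K` comes from `P ⊗_R K`. -/
theorem BalTensor.exists_of_map_mkQ_eq_zero (K : Submodule R N) (z : BalTensor k R P N)
    (hz : BalTensor.map LinearMap.id K.mkQ z = 0) :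
    ∃ w : BalTensor k R P K, BalTensor.map LinearMap.id K.subtype w = z := by
  let I := LinearMap.range (BalTensor.map (k := k) (LinearMap.id : P →ₗ[Rᵐᵒᵖ] P) K.subtype)
  let s : P →ₗ[k] (N ⧸ K) →ₗ[k] (BalTensor k R P N ⧸ I) :=
    LinearMap.flip ((K.restrictScalars k).liftQ ((BalTensor.mk k R).flip.compr₂ I.mkQ) (by
      intro n hn
      rw [LinearMap.mem_ker]
      ext p
      refine (Submodule.Quotient.mk_eq_zero I).2 ⟨BalTensor.mk k R p ⟨n, hn⟩, rfl⟩))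
  -- The map p ⊗ [n] ↦ [p ⊗ n] into the cokernel of P ⊗ K → P ⊗ N. Its existence shows that whatever
  -- dies in P ⊗ N/K lies in the image `I`.
  let t : BalTensor k R P (N ⧸ K) →ₗ[k] (BalTensor k R P N ⧸ I) :=
    BalTensor.lift (TensorProduct.lift s) (by
      intro p r n
      obtain ⟨n, rfl⟩ := Submodule.Quotient.mk_surjective _ n
      exact congrArg I.mkQ (BalTensor.mk_smul k R p r n))
  have key : t ∘ₗ BalTensor.map LinearMap.id K.mkQ = I.mkQ := BalTensor.ext fun p n => rfl
  have h := LinearMap.congr_fun key z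
  rw [LinearMap.comp_apply, hz, map_zero] at h
  exact (Submodule.Quotient.mk_eq_zero I).1 h.symm

/-- Factor f through N/ker f: flatness makes the second map injective after tensoring, and right
exactness handles the first. -/
theorem IsRightFaithfullyFlat.exists_of_map_eq_zero (hP : IsRightFaithfullyFlat k R P)
    (f : N →ₗ[R] N') (z : BalTensor k R P N) (hz : BalTensor.map LinearMap.id f z = 0) :
    ∃ w : BalTensor k R P (LinearMap.ker f),
      BalTensor.map LinearMap.id (LinearMap.ker f).subtype w = z := by
  refine BalTensor.exists_of_map_mkQ_eq_zero _ z ?_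
  apply hP.map_injective ((LinearMap.ker f).liftQ f le_rfl)
    (LinearMap.ker_eq_bot.1 (Submodule.ker_liftQ_eq_bot _ _ _ le_rfl))
  rw [map_zero, ← hz, ← LinearMap.comp_apply]
  congr 1
  exact BalTensor.ext fun p n => rfl

end Kernel

/-! ### The structure theorem for relative Hopf modules -/

section GaloisMap

variable {k H A W : Type*} [CommRing k] [Ring H] [HopfAlgebra k H]
  [Ring A] [Algebra k A] [HComoduleAlgebra k H A]
  [AddCommGroup W] [Module k W] [Module (coinvAlg k H A) W] [IsScalarTower k (coinvAlg k H A) W]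

/-- The action `(a ⊗ h) w = σ(a) w ⊗ h`. -/
def tensorOfAct (k H : Type*) {A W : Type*} [CommRing k] [Ring H] [HopfAlgebra k H]
    [Ring A] [Algebra k A] [AddCommGroup W] [Module k W] (σ : A →ₗ[k] W →ₗ[k] W) :
    A ⊗[k] H →ₗ[k] W →ₗ[k] W ⊗[k] H :=
  TensorProduct.lift (LinearMap.mk₂ k (fun a h => (TensorProduct.mk k W H).flip h ∘ₗ σ a)
    (fun a a' h => by ext w; simp)
    (fun c a h => by ext w; simp [smul_tmul'])
    (fun a h h' => by ext w; simp)
    (fun c a h => by ext w; simp))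

@[simp] theorem tensorOfAct_tmul (σ : A →ₗ[k] W →ₗ[k] W) (a : A) (h : H) (w : W) :
    tensorOfAct k H σ (a ⊗ₜ h) w = σ a w ⊗ₜ h := rfl

/-- The map `A ⊗_{A^{co H}} W → W ⊗ H`, `a ⊗ w ↦ a₀ w ⊗ a₁`, for an action `σ` of `A` on `W`. -/
def galoisMap (σ : A →ₗ[k] W →ₗ[k] W) (hmul : ∀ a b w, σ (a * b) w = σ a (σ b w))
    (hco : ∀ (c : coinvAlg k H A) w, σ (c : A) w = c • w) :
    BalTensor k (coinvAlg k H A) A W →ₗ[k] W ⊗[k] H :=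
  BalTensor.lift (TensorProduct.lift (tensorOfAct k H σ ∘ₗ coact)) (fun a c w => by
    simp only [TensorProduct.lift.tmul, LinearMap.comp_apply, subalgebra_op_smul, op_smul_eq_mul,
      HComoduleAlgebra.coact_mul, coact_coinvAlg]
    generalize (coact a : A ⊗[k] H) = t
    induction t with
    | zero => simp
    | add x y hx hy => simp only [add_mul, map_add, LinearMap.add_apply, hx, hy]
    | tmul b h => simp [hmul, hco])

theorem galoisMap_mk (σ : A →ₗ[k] W →ₗ[k] W) (hmul hco) (a : A) (w : W) :
    galoisMap (H := H) σ hmul hco (BalTensor.mk k _ a w) = tensorOfAct k H σ (coact a) w := rfl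

/-- If `can'` is bijective then `a ⊗ w ↦ a₀ w ⊗ a₁` is injective. -/
theorem galoisMap_injective (hA : Function.Bijective (can' k H A)) (σ : A →ₗ[k] W →ₗ[k] W)
    (hone : ∀ w, σ 1 w = w) (hmul hco) : Function.Injective (galoisMap (H := H) σ hmul hco) := by
  let e := LinearEquiv.ofBijective (can' k H A) hA
  have he : ∀ z, e z = can' k H A z := fun _ => rfl
  -- `act w` is l ⊗ r ↦ l ⊗ r w.
  let act : W →ₗ[k] BalTensor k (coinvAlg k H A) A A →ₗ[k] BalTensor k (coinvAlg k H A) A W :=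
    { toFun := fun w => BalTensor.lift
        (TensorProduct.lift ((BalTensor.mk k _).compl₁₂ LinearMap.id (σ.flip w)))
        (fun a c b => by simp [BalTensor.mk_smul, Subalgebra.smul_def, hmul, hco])
      map_add' := fun w w' => BalTensor.ext fun a b => by simp
      map_smul' := fun c w => BalTensor.ext fun a b => by simp }
  have act_mk : ∀ w a b, act w (BalTensor.mk k _ a b) = BalTensor.mk k _ a (σ b w) :=
    fun _ _ _ => rfl
  have act_right : ∀ (b : A) w z, act w (balRightMul b z) = act (σ b w) z := by
    intro b w z
    induction z using BalTensor.induction with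
    | zero => simp
    | add x y hx hy => simp only [map_add, hx, hy]
    | tmul l r => simp [balRightMul, act_mk, hmul]
  have can_right : ∀ (b : A) z, can' k H A (balRightMul b z) = can' k H A z * (b ⊗ₜ[k] (1 : H)) := by
    intro b z
    induction z using BalTensor.induction with
    | zero => simp
    | add x y hx hy => simp only [map_add, add_mul, hx, hy]
    | tmul l r => simp [balRightMul, mul_assoc]
  have e_right : ∀ (b : A) h, e.symm (b ⊗ₜ h) = balRightMul b (e.symm ((1 : A) ⊗ₜ h)) := by
    intro b h
    apply e.injective
    rw [e.apply_symm_apply, he, can_right, ← he, e.apply_symm_apply]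
    simp
  -- The left inverse: w ⊗ h ↦ ∑ l ⊗ r w, where ∑ l ⊗ r is the preimage of 1 ⊗ h under `can'`. Right
  -- A-linearity of `can'` extends this rule to the preimage of any b ⊗ h, and the preimage of ρ(a)
  -- is a ⊗ 1.
  let L : W ⊗[k] H →ₗ[k] BalTensor k (coinvAlg k H A) A W :=
    TensorProduct.lift (act.compl₂
      (e.symm.toLinearMap ∘ₗ (Algebra.TensorProduct.includeRight : H →ₐ[k] A ⊗[k] H).toLinearMap))
  have hL : ∀ t w, L (tensorOfAct k H σ t w) = act w (e.symm t) := by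
    intro t w
    induction t with
    | zero => simp
    | add x y hx hy => simp only [map_add, LinearMap.add_apply, hx, hy]
    | tmul b h =>
      rw [e_right, act_right]
      simp [L]
  refine Function.LeftInverse.injective (g := L) fun z => ?_
  induction z using BalTensor.induction with
  | zero => simp
  | add x y hx hy => simp only [map_add, hx, hy]
  | tmul a w =>
    rw [galoisMap_mk, hL]
    have h : e.symm (coact a) = BalTensor.mk k _ a 1 := by
      apply e.injective
      rw [e.apply_symm_apply, he, can'_mk, ← Algebra.TensorProduct.one_def, mul_one]
    rw [h, act_mk, hone]

end GaloisMap

/-! ### The equalizer defining the coinvariants, after tensoring with A -/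

section Structure

variable {k H A M : Type*} [CommRing k] [Ring H] [HopfAlgebra k H]
  [Ring A] [Algebra k A] [HComoduleAlgebra k H A]
  [AddCommGroup M] [Module k M] [HComodule k H M]
  [Module A M] [IsScalarTower k A M]

variable (k H A M) in
/-- The map `A ⊗_{A^{co H}} M → M ⊗ H`, `a ⊗ m ↦ a₀ m ⊗ a₁`. -/
def leftGaloisMap : BalTensor k (coinvAlg k H A) A M →ₗ[k] M ⊗[k] H :=
  galoisMap (Algebra.lsmul k k M : A →ₐ[k] _).toLinearMap (fun a b w => mul_smul a b w)
    (fun _ _ => rfl)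

theorem leftGaloisMap_mk (a : A) (m : M) : leftGaloisMap k H A M (BalTensor.mk k _ a m) =
    tensorLeftAct k H A M (coact a) (m ⊗ₜ 1) := by
  change tensorOfAct k H _ (coact a) m = _
  generalize (coact a : A ⊗[k] H) = t
  induction t with
  | zero => simp
  | add x y hx hy => simp only [map_add, LinearMap.add_apply, hx, hy]
  | tmul b h => simp [tensorLeftAct]

theorem leftGaloisMap_injective (hA : Function.Bijective (can' k H A)) :
    Function.Injective (leftGaloisMap k H A M) :=
  galoisMap_injective hA _ (fun w => one_smul A w) _ _

variable [IsLeftRelHopf k H A M]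

/-- The counit splits the coaction. -/
theorem coact_injective : Function.Injective (coact (k := k) (H := H) (M := M)) := by
  have h := HComodule.counit (k := k) (H := H) (M := M)
  intro x y hxy
  rw [← LinearMap.id_apply (R := k) x, ← LinearMap.id_apply (R := k) y, ← h]
  simp only [LinearMap.comp_apply, hxy]

variable (k H A M) in
/-- The map `A ⊗_{A^{co H}} M^{co H} → M`, `a ⊗ m ↦ a m`. -/
def coinvStructureMap : BalTensor k (coinvAlg k H A) A (coinv k H M) →ₗ[k] M :=
  BalTensor.lift (TensorProduct.lift
    ((Algebra.lsmul k k M : A →ₐ[k] _).toLinearMap.compl₂ (coinv k H M).subtype))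
    (fun a c m => by simp [subalgebra_op_smul, coe_smul_coinv])

theorem coinvStructureMap_mk (a : A) (m : coinv k H M) :
    coinvStructureMap k H A M (BalTensor.mk k _ a m) = a • (m : M) := rfl

variable (k H A M) in
/-- The inclusion `M^{co H} → M`, as an `A^{co H}`-linear map. -/
def coinvIncl : coinv k H M →ₗ[coinvAlg k H A] M where
  toFun := Subtype.val
  map_add' _ _ := rfl
  map_smul' _ _ := rfl

/-- ρ(am) = a₀m ⊗ a₁ for coinvariant m. This square lets the structure map be studied through
`leftGaloisMap`. -/
theorem coact_coinvStructureMap (z : BalTensor k (coinvAlg k H A) A (coinv k H M)) :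
    coact (coinvStructureMap k H A M z) =
      leftGaloisMap k H A M (BalTensor.map LinearMap.id (coinvIncl k H A M) z) := by
  induction z using BalTensor.induction with
  | zero => simp
  | add x y hx hy => simp only [map_add, hx, hy]
  | tmul a m =>
    rw [coinvStructureMap_mk, IsLeftRelHopf.coact_smul, mem_coinv.1 m.2, BalTensor.map_mk,
      leftGaloisMap_mk]
    rfl

variable (k H A M) in
/-- The map `A ⊗_{A^{co H}} A → A ⊗_{A^{co H}} M`, `l ⊗ r ↦ l ⊗ r m`. -/
def balActOn (m : M) :
    BalTensor k (coinvAlg k H A) A A →ₗ[k] BalTensor k (coinvAlg k H A) A M :=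
  BalTensor.map LinearMap.id
    (LinearMap.restrictScalars (coinvAlg k H A) (LinearMap.toSpanSingleton A M m))

theorem balActOn_mk (m : M) (l r : A) :
    balActOn k H A M m (BalTensor.mk k _ l r) = BalTensor.mk k _ l (r • m) := rfl

/-- Both sides are a₀bm ⊗ a₁ on a ⊗ b. It serves to hit m ⊗ h below, and later to evaluate at
γ_A(h). -/
theorem leftGaloisMap_balActOn (m : M) (z : BalTensor k (coinvAlg k H A) A A) :
    leftGaloisMap k H A M (balActOn k H A M m z) =
      tensorLeftAct k H A M (can' k H A z) (m ⊗ₜ 1) := by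
  induction z using BalTensor.induction with
  | zero => simp
  | add x y hx hy => simp only [map_add, LinearMap.add_apply, hx, hy]
  | tmul a b =>
    rw [balActOn_mk, leftGaloisMap_mk, can'_mk]
    generalize (coact a : A ⊗[k] H) = t
    induction t with
    | zero => simp
    | add x y hx hy => simp only [map_add, LinearMap.add_apply, add_mul, hx, hy]
    | tmul b h => simp [tensorLeftAct]

theorem leftGaloisMap_surjective (hA : Function.Bijective (can' k H A)) :
    Function.Surjective (leftGaloisMap k H A M) := by
  intro t
  induction t with
  | zero => exact ⟨0, map_zero _⟩
  | add x y hx hy =>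
    obtain ⟨x, rfl⟩ := hx
    obtain ⟨y, rfl⟩ := hy
    exact ⟨x + y, map_add _ _ _⟩
  | tmul m h =>
    obtain ⟨z, hz⟩ := hA.2 ((1 : A) ⊗ₜ h)
    exact ⟨balActOn k H A M m z, by rw [leftGaloisMap_balActOn, hz]; simp [tensorLeftAct]⟩

theorem tensorLeftAct_mul (s t : A ⊗[k] H) (x : M ⊗[k] H) :
    tensorLeftAct k H A M (s * t) x = tensorLeftAct k H A M s (tensorLeftAct k H A M t x) := by
  induction s with
  | zero => simp
  | add s s' hs hs' => simp only [map_add, LinearMap.add_apply, add_mul, hs, hs']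
  | tmul a h =>
    induction t with
    | zero => simp
    | add t t' ht ht' => simp only [map_add, LinearMap.add_apply, mul_add, ht, ht']
    | tmul b g =>
      induction x with
      | zero => simp
      | add x x' hx hx' => simp only [map_add, hx, hx']
      | tmul m u => simp [tensorLeftAct, mul_assoc]

variable (k H A M) in
/-- The map `A ⊗_{A^{co H}} (M ⊗ H) → (M ⊗ H) ⊗ H`, `a ⊗ m ⊗ h ↦ a₀ m ⊗ a₁ h ⊗ a₂`. -/
def diagonalGaloisMap : BalTensor k (coinvAlg k H A) A (M ⊗[k] H) →ₗ[k] (M ⊗[k] H) ⊗[k] H :=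
  galoisMap (tensorLeftAct k H A M ∘ₗ coact)
    (fun a b w => by
      rw [LinearMap.comp_apply, HComoduleAlgebra.coact_mul, tensorLeftAct_mul]
      rfl)
    (fun c w => by
      rw [LinearMap.comp_apply, coact_coinvAlg]
      induction w with
      | zero => simp
      | add x y hx hy => simp only [map_add, smul_add, hx, hy]
      | tmul m h => simp [tensorLeftAct, smul_tmul', Subalgebra.smul_def])

theorem diagonalGaloisMap_injective (hA : Function.Bijective (can' k H A)) :
    Function.Injective (diagonalGaloisMap k H A M) :=
  galoisMap_injective hA _ (fun w => by
    rw [LinearMap.comp_apply, HComoduleAlgebra.coact_one]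
    induction w with
    | zero => simp
    | add x y hx hy => simp only [map_add, hx, hy]
    | tmul m h => simp [tensorLeftAct]) _ _

variable (k H A M) in
/-- The coaction as an `A^{co H}`-linear map. -/
def coactCoinvLinear : M →ₗ[coinvAlg k H A] M ⊗[k] H where
  toFun := coact
  map_add' := map_add _
  map_smul' c m := by
    rw [Subalgebra.smul_def, IsLeftRelHopf.coact_smul, coact_coinvAlg, RingHom.id_apply]
    generalize (coact m : M ⊗[k] H) = t
    induction t with
    | zero => simp
    | add x y hx hy => simp only [map_add, smul_add, hx, hy]
    | tmul m h => simp [tensorLeftAct, smul_tmul', Subalgebra.smul_def]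

variable (k H A M) in
/-- The map `m ↦ m ⊗ 1` as an `A^{co H}`-linear map. -/
def tmulOneCoinvLinear : M →ₗ[coinvAlg k H A] M ⊗[k] H where
  toFun m := m ⊗ₜ 1
  map_add' m n := add_tmul m n 1
  map_smul' _ _ := rfl

/-- Together with `diagonalGaloisMap_tmul_one`, this says that the Galois maps carry the pair A ⊗ ρ,
A ⊗ (- ⊗ 1) to the pair ρ ⊗ H, M ⊗ Δ on M ⊗ H. Here both sides are a₀m₀ ⊗ a₁m₁ ⊗ a₂. -/
theorem diagonalGaloisMap_coact (z : BalTensor k (coinvAlg k H A) A M) :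
    diagonalGaloisMap k H A M (BalTensor.map LinearMap.id (coactCoinvLinear k H A M) z) =
      (coact (k := k) (H := H) (M := M)).rTensor H (leftGaloisMap k H A M z) := by
  induction z using BalTensor.induction with
  | zero => simp
  | add x y hx hy => simp only [map_add, hx, hy]
  | tmul a m =>
    rw [BalTensor.map_mk, leftGaloisMap_mk]
    change tensorOfAct k H _ (coact a) (coact m) = _
    generalize (coact a : A ⊗[k] H) = t
    induction t with
    | zero => simp
    | add x y hx hy => simp only [map_add, LinearMap.add_apply, hx, hy]
    | tmul b h => simp [tensorLeftAct, IsLeftRelHopf.coact_smul]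

theorem diagonalGaloisMap_tmul_one (z : BalTensor k (coinvAlg k H A) A M) :
    TensorProduct.assoc k M H H (diagonalGaloisMap k H A M
      (BalTensor.map LinearMap.id (tmulOneCoinvLinear k H A M) z)) =
      (Coalgebra.comul (R := k) (A := H)).lTensor M (leftGaloisMap k H A M z) := by
  induction z using BalTensor.induction with
  | zero => simp
  | add x y hx hy => simp only [map_add, hx, hy]
  | tmul a m =>
    rw [BalTensor.map_mk, leftGaloisMap_mk]
    change TensorProduct.assoc k M H H (tensorOfAct k H _ (coact a) (m ⊗ₜ[k] (1 : H))) = _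
    -- The left side is the image of (ρ ⊗ H)(t) under b ↦ bm on the first factor, so the claim
    -- reduces to coassociativity of A.
    have h1 : ∀ t : A ⊗[k] H, TensorProduct.assoc k M H H
        (tensorOfAct k H (tensorLeftAct k H A M ∘ₗ coact) t (m ⊗ₜ[k] (1 : H))) =
        (LinearMap.rTensor (H ⊗[k] H) (LinearMap.toSpanSingleton A M m |>.restrictScalars k))
          (TensorProduct.assoc k A H H ((coact (k := k) (H := H)).rTensor H t)) := by
      intro t
      induction t with
      | zero => simp
      | add x y hx hy => simp only [map_add, LinearMap.add_apply, hx, hy]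
      | tmul b h =>
        rw [tensorOfAct_tmul, LinearMap.rTensor_tmul, LinearMap.comp_apply]
        generalize (coact b : A ⊗[k] H) = s
        induction s with
        | zero => simp
        | add x y hx hy => simp only [map_add, LinearMap.add_apply, add_tmul, hx, hy]
        | tmul c g => simp [tensorLeftAct]
    have h2 := LinearMap.congr_fun (HComodule.coassoc (k := k) (H := H) (M := A)) a
    simp only [LinearMap.comp_apply, LinearEquiv.coe_coe] at h2
    rw [h1, h2]
    generalize (coact a : A ⊗[k] H) = t
    induction t with
    | zero => simp
    | add x y hx hy => simp only [map_add, LinearMap.add_apply, hx, hy]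
    | tmul b h => simp [tensorLeftAct]

/-- The structure theorem for relative Hopf modules: `A ⊗_{A^{co H}} M^{co H} ≅ M`. -/
theorem coinvStructureMap_bijective (hA : IsRightFFGalois k H A) :
    Function.Bijective (coinvStructureMap k H A M) := by
  have hcan := hA.can'_bijective
  constructor
  · have h : Function.Injective (coact (k := k) (H := H) ∘ coinvStructureMap k H A M) := by
      rw [show _ ∘ _ = _ from funext coact_coinvStructureMap]
      exact (leftGaloisMap_injective hcan).comp
        (hA.faithfullyFlat.map_injective _ Subtype.val_injective)
    exact h.of_comp
  · intro m
    obtain ⟨z, hz⟩ := leftGaloisMap_surjective (M := M) hcan (coact m)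
    -- Coassociativity of M says that ρ(m) is equalized by ρ ⊗ H and M ⊗ Δ; injectivity of
    -- `diagonalGaloisMap` pulls this back to z.
    have hker : BalTensor.map (k := k) (LinearMap.id : A →ₗ[(coinvAlg k H A)ᵐᵒᵖ] A)
        (coactCoinvLinear k H A M - tmulOneCoinvLinear k H A M) z = 0 := by
      have hsub : BalTensor.map (k := k) (LinearMap.id : A →ₗ[(coinvAlg k H A)ᵐᵒᵖ] A)
          (coactCoinvLinear k H A M - tmulOneCoinvLinear k H A M) =
          BalTensor.map LinearMap.id (coactCoinvLinear k H A M) -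
          BalTensor.map LinearMap.id (tmulOneCoinvLinear k H A M) :=
        BalTensor.ext fun a m => by simp
      rw [hsub, LinearMap.sub_apply, sub_eq_zero]
      apply diagonalGaloisMap_injective hcan
      apply (TensorProduct.assoc k M H H).injective
      rw [diagonalGaloisMap_coact, diagonalGaloisMap_tmul_one, hz]
      exact LinearMap.congr_fun (HComodule.coassoc (k := k) (H := H) (M := M)) m
    obtain ⟨w, hw⟩ := hA.faithfullyFlat.exists_of_map_eq_zero _ z hker
    -- By flatness z comes from A ⊗ K, and K is M₀ as a submodule; `j` is this identification.
    let K := LinearMap.ker (coactCoinvLinear k H A M - tmulOneCoinvLinear k H A M)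
    let j : K →ₗ[coinvAlg k H A] coinv k H M :=
      { toFun := fun n => ⟨n, mem_coinv.2 (sub_eq_zero.1 n.2)⟩
        map_add' := fun _ _ => rfl
        map_smul' := fun _ _ => rfl }
    refine ⟨BalTensor.map LinearMap.id j w, coact_injective (k := k) (H := H) ?_⟩
    rw [coact_coinvStructureMap, ← hz, ← hw, ← LinearMap.comp_apply (BalTensor.map _ _)]
    congr 2
    exact BalTensor.ext fun a n => rfl

end Structure

/-! ### The isomorphism `X ⊗_{A^{co H}} M^{co H} ≅ X ⊗_A M` -/

section CoinvTensor

variable {k H A M : Type*} [CommRing k] [Ring H] [HopfAlgebra k H]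
  [Ring A] [Algebra k A] [HComoduleAlgebra k H A]
  [AddCommGroup M] [Module k M] [HComodule k H M]
  [Module A M] [IsScalarTower k A M] [IsLeftRelHopf k H A M]
variable {X : Type*} [AddCommGroup X] [Module k X] [Module Aᵐᵒᵖ X] [IsScalarTower k Aᵐᵒᵖ X]

variable (k H) in
/-- The right `A^{co H}`-linear map `A → X`, `a ↦ x a`. -/
def rightOrbit (x : X) : A →ₗ[(coinvAlg k H A)ᵐᵒᵖ] X where
  toFun a := op a • x
  map_add' a b := by rw [op_add, add_smul]
  map_smul' c a := mul_smul (op (c.unop : A)) (op a) x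

variable (k H A M) in
/-- The map `A ⊗_{A^{co H}} M^{co H} → X ⊗_{A^{co H}} M^{co H}`, `a ⊗ m ↦ x a ⊗ m`. -/
def coinvTensorOrbit (x : X) :
    BalTensor k (coinvAlg k H A) A (coinv k H M) →ₗ[k] CoinvTensor k H A M X :=
  BalTensor.map (rightOrbit k H x) LinearMap.id

theorem coinvTensorOrbit_mk (x : X) (a : A) (m : coinv k H M) :
    coinvTensorOrbit k H A M x (BalTensor.mk k _ a m) = BalTensor.mk k _ (op a • x) m := rfl

theorem coinvTensorMap_orbit (x : X) (t : BalTensor k (coinvAlg k H A) A (coinv k H M)) :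
    coinvTensorMap k H A M X (coinvTensorOrbit k H A M x t) =
      BalTensor.mk k A x (coinvStructureMap k H A M t) := by
  induction t using BalTensor.induction with
  | zero => simp
  | add s t hs ht => simp only [map_add, hs, ht]
  | tmul a m =>
    rw [coinvTensorOrbit_mk, coinvTensorMap_mk, coinvStructureMap_mk, BalTensor.mk_smul]

theorem coinvStructureMap_orbit (a : A) (t : BalTensor k (coinvAlg k H A) A (coinv k H M)) :
    coinvStructureMap k H A M (coinvTensorOrbit k H A M a t) =
      a • coinvStructureMap k H A M t := by
  induction t using BalTensor.induction with
  | zero => simp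
  | add s t hs ht => simp only [map_add, smul_add, hs, ht]
  | tmul b m =>
    rw [coinvTensorOrbit_mk, coinvStructureMap_mk, coinvStructureMap_mk, op_smul_eq_mul, mul_smul]

theorem coinvTensorOrbit_orbit (x : X) (a : A)
    (t : BalTensor k (coinvAlg k H A) A (coinv k H M)) :
    coinvTensorOrbit k H A M x (coinvTensorOrbit k H A M a t) =
      coinvTensorOrbit k H A M (op a • x) t := by
  induction t using BalTensor.induction with
  | zero => simp
  | add s t hs ht => simp only [map_add, hs, ht]
  | tmul b m =>
    rw [coinvTensorOrbit_mk, coinvTensorOrbit_mk, coinvTensorOrbit_mk, op_smul_eq_mul, op_mul,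
      mul_smul]

/-- The structure theorem tensored with X over A. The inverse `V` sends x ⊗ m to ∑ xaᵢ ⊗ mᵢ, where m
= ∑ aᵢmᵢ with coinvariant mᵢ. -/
theorem coinvTensorMap_bijective (hA : IsRightFFGalois k H A) :
    Function.Bijective (coinvTensorMap k H A M X) := by
  let e := LinearEquiv.ofBijective (coinvStructureMap k H A M) (coinvStructureMap_bijective hA)
  have he : ∀ t, e t = coinvStructureMap k H A M t := fun _ => rfl
  let U : X →ₗ[k] BalTensor k (coinvAlg k H A) A (coinv k H M) →ₗ[k] CoinvTensor k H A M X :=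
    { toFun := coinvTensorOrbit k H A M
      map_add' := fun x y => BalTensor.ext fun a m => by simp [coinvTensorOrbit_mk]
      map_smul' := fun c x => BalTensor.ext fun a m => by
        simp [coinvTensorOrbit_mk, smul_comm _ c x] }
  let V : BalTensor k A X M →ₗ[k] CoinvTensor k H A M X :=
    BalTensor.lift (TensorProduct.lift (U.compl₂ e.symm.toLinearMap)) (fun x a m => by
      obtain ⟨t, rfl⟩ := e.surjective m
      have h : e.symm (a • e t) = coinvTensorOrbit k H A M a t := by
        rw [LinearEquiv.symm_apply_eq, he, he, coinvStructureMap_orbit]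
      change coinvTensorOrbit k H A M _ (e.symm (e t)) =
        coinvTensorOrbit k H A M x (e.symm (a • e t))
      rw [h, coinvTensorOrbit_orbit, e.symm_apply_apply])
  refine Function.bijective_iff_has_inverse.2 ⟨V, fun z => ?_, fun z => ?_⟩
  · induction z using BalTensor.induction with
    | zero => simp
    | add s t hs ht => simp only [map_add, hs, ht]
    | tmul x m =>
      have h : e.symm (m : M) = BalTensor.mk k _ 1 m := by
        rw [LinearEquiv.symm_apply_eq, he, coinvStructureMap_mk, one_smul]
      change coinvTensorOrbit k H A M x (e.symm (m : M)) = _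
      rw [h, coinvTensorOrbit_mk, op_one, one_smul]
  · induction z using BalTensor.induction with
    | zero => simp
    | add s t hs ht => simp only [map_add, hs, ht]
    | tmul x m =>
      change coinvTensorMap k H A M X (coinvTensorOrbit k H A M x (e.symm m)) = _
      rw [coinvTensorMap_orbit, ← he, e.apply_symm_apply]

end CoinvTensor

/-! ### The Morita context of the coinvariants -/

section Morita

variable {k H A B M N : Type*} [CommRing k] [Ring H] [HopfAlgebra k H]
  [Ring A] [Algebra k A] [HComoduleAlgebra k H A]
  [Ring B] [Algebra k B] [HComoduleAlgebra k H B]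
  [AddCommGroup M] [Module k M] [HComodule k H M]
  [Module A M] [IsScalarTower k A M] [Module Bᵐᵒᵖ M] [IsScalarTower k Bᵐᵒᵖ M]
  [SMulCommClass A Bᵐᵒᵖ M] [IsLeftRelHopf k H A M] [IsRightRelHopf k H B M]
  [AddCommGroup N] [Module k N] [HComodule k H N]
  [Module B N] [IsScalarTower k B N] [Module Aᵐᵒᵖ N] [IsScalarTower k Aᵐᵒᵖ N]
  [SMulCommClass B Aᵐᵒᵖ N] [IsLeftRelHopf k H B N] [IsRightRelHopf k H A N]

theorem balCoact_mk_coinv (m : coinv k H M) (n : coinv k H N) :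
    balCoact k H B M N (BalTensor.mk k B (m : M) (n : N)) =
      BalTensor.mk k B (m : M) (n : N) ⊗ₜ 1 := by
  change TensorProduct.map₂ (BalTensor.mk k B) (LinearMap.mul k H) (coact (m : M))
    (coact (n : N)) = _
  rw [mem_coinv.1 m.2, mem_coinv.1 n.2]
  simp

namespace HMoritaContext

variable (c : HMoritaContext k H A B M N)

/-- `α(m ⊗ n)`, for coinvariant `m` and `n`. -/
def αCoinv (m : coinv k H M) (n : coinv k H N) : coinvAlg k H A :=
  ⟨c.α (BalTensor.mk k B (m : M) (n : N)), by
    change coact _ = _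
    rw [c.α_colinear, balCoact_mk_coinv, LinearMap.rTensor_tmul]⟩

/-- `β(n ⊗ m)`, for coinvariant `m` and `n`. -/
def βCoinv (n : coinv k H N) (m : coinv k H M) : coinvAlg k H B :=
  ⟨c.β (BalTensor.mk k A (n : N) (m : M)), by
    change coact _ = _
    rw [c.β_colinear, balCoact_mk_coinv, LinearMap.rTensor_tmul]⟩

/-- The linear map `M^{co H} ⊗ N^{co H} → A`, `m ⊗ n ↦ α(m ⊗ n)`. -/
def αTensor : coinv k H M ⊗[k] coinv k H N →ₗ[k] A :=
  c.α ∘ₗ TensorProduct.lift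
    ((BalTensor.mk k B).compl₁₂ (coinv k H M).subtype (coinv k H N).subtype)

theorem αTensor_tmul (m : coinv k H M) (n : coinv k H N) :
    c.αTensor (m ⊗ₜ n) = c.αCoinv m n := rfl

/-- The image of `M^{co H} ⊗ N^{co H}` in `A^{co H}`, as a left ideal. -/
def αIdeal : Submodule (coinvAlg k H A) (coinvAlg k H A) where
  carrier := {x | ∃ t, c.αTensor t = x}
  add_mem' := by
    rintro _ _ ⟨s, hs⟩ ⟨t, ht⟩
    exact ⟨s + t, by rw [map_add, hs, ht]; rfl⟩
  zero_mem' := ⟨0, map_zero _⟩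
  smul_mem' := by
    rintro a x ⟨t, ht⟩
    refine ⟨(Algebra.lsmul k k (coinv k H M) a).rTensor _ t, ?_⟩
    rw [smul_eq_mul, Subalgebra.coe_mul, ← ht]
    clear ht
    induction t with
    | zero => simp
    | add s t hs ht => simp only [map_add, mul_add, hs, ht]
    | tmul m n =>
      rw [LinearMap.rTensor_tmul, αTensor_tmul, αTensor_tmul]
      exact c.α_left _ _ _

theorem αCoinv_mem (m : coinv k H M) (n : coinv k H N) : c.αCoinv m n ∈ c.αIdeal :=
  ⟨m ⊗ₜ n, rfl⟩

/-- By faithfulness it suffices that A ⊗_{A₀} A₀/I = 0. Since a ⊗ [x] = ax ⊗ [1] = `Φ (a * x)`, this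
means Φ = 0. It vanishes on A α(M₀ ⊗ N₀), and A α(M ⊗ N) is no larger. -/
theorem subsingleton_quotient_αIdeal (hA : IsRightFFGalois k H A) (hB : IsRightFFGalois k H B)
    (hα : Function.Surjective c.α) : Subsingleton (coinvAlg k H A ⧸ c.αIdeal) := by
  refine hA.faithfullyFlat.faithful _ ?_
  let Q := coinvAlg k H A ⧸ c.αIdeal
  let Φ : A →ₗ[k] BalTensor k (coinvAlg k H A) A Q :=
    (BalTensor.mk k _).flip (Submodule.Quotient.mk 1)
  have hΦ : ∀ (a : A) (x : coinvAlg k H A),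
      BalTensor.mk k (coinvAlg k H A) a (Submodule.Quotient.mk x : Q) = Φ (a * x) := by
    intro a x
    change _ = BalTensor.mk k (coinvAlg k H A) (op x • a) (Submodule.Quotient.mk 1 : Q)
    rw [BalTensor.mk_smul, ← Submodule.Quotient.mk_smul, smul_eq_mul, mul_one]
  have h0 : ∀ (a : A) (m : coinv k H M) (n : coinv k H N), Φ (a * c.αCoinv m n) = 0 := by
    intro a m n
    rw [← hΦ, (Submodule.Quotient.mk_eq_zero _).2 (c.αCoinv_mem m n), map_zero]
  -- M = A M₀, and left linearity of α absorbs the coefficient into a.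
  have h1 : ∀ (a : A) (m : M) (n : coinv k H N),
      Φ (a * c.α (BalTensor.mk k B m (n : N))) = 0 := by
    intro a m n
    obtain ⟨t, rfl⟩ := (coinvStructureMap_bijective (M := M) hA).2 m
    induction t using BalTensor.induction with
    | zero => simp
    | add s t hs ht => simp only [map_add, LinearMap.add_apply, mul_add, hs, ht, add_zero]
    | tmul b m =>
      rw [coinvStructureMap_mk, c.α_left, ← mul_assoc]
      exact h0 _ _ _
  -- N = B N₀, and the coefficient in B moves across ⊗_B into M; this is why `h1` allows all m in M.
  have h2 : ∀ (a : A) (t : BalTensor k B M N), Φ (a * c.α t) = 0 := by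
    intro a t
    induction t using BalTensor.induction with
    | zero => simp
    | add s t hs ht => simp only [map_add, mul_add, hs, ht, add_zero]
    | tmul m n =>
      obtain ⟨t, rfl⟩ := (coinvStructureMap_bijective (M := N) hB).2 n
      induction t using BalTensor.induction with
      | zero => simp
      | add s t hs ht => simp only [map_add, mul_add, hs, ht, add_zero]
      | tmul b n =>
        rw [coinvStructureMap_mk, ← BalTensor.mk_smul]
        exact h1 _ _ _
  have h3 : ∀ z : BalTensor k (coinvAlg k H A) A Q, z = 0 := by
    intro z
    induction z using BalTensor.induction with
    | zero => rfl
    | add s t hs ht => rw [hs, ht, add_zero]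
    | tmul a q =>
      obtain ⟨x, rfl⟩ := Submodule.Quotient.mk_surjective _ q
      obtain ⟨t, ht⟩ := hα 1
      rw [hΦ, ← mul_one (a * (x : A)), ← ht, h2]
  exact ⟨fun x y => (h3 x).trans (h3 y).symm⟩

/-- The map `M^{co H} ⊗ N^{co H} → A^{co H}` is surjective. -/
theorem exists_sum_αCoinv_eq_one (hA : IsRightFFGalois k H A) (hB : IsRightFFGalois k H B)
    (hα : Function.Surjective c.α) : ∃ S : Finset (coinv k H M × coinv k H N),
      ∑ i ∈ S, c.α (BalTensor.mk k B (i.1 : M) (i.2 : N)) = 1 := by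
  have := c.subsingleton_quotient_αIdeal hA hB hα
  obtain ⟨t, ht⟩ : (1 : coinvAlg k H A) ∈ c.αIdeal :=
    (Submodule.Quotient.mk_eq_zero _).1 (Subsingleton.elim _ _)
  obtain ⟨S, rfl⟩ := TensorProduct.exists_finset t
  refine ⟨S, ?_⟩
  rw [map_sum] at ht
  exact ht

/-! ### Contraction against N and the inverse of φ -/

variable {X Y : Type*}
  [AddCommGroup X] [Module k X] [Module Aᵐᵒᵖ X] [IsScalarTower k Aᵐᵒᵖ X]
  [AddCommGroup Y] [Module k Y] [Module Aᵐᵒᵖ Y] [IsScalarTower k Aᵐᵒᵖ Y]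

/-- The map `Y ⊗_{A^{co H}} M^{co H} → Y`, `y ⊗ m ↦ y α(m ⊗ n)`. -/
def contract (n : N) : CoinvTensor k H A M Y →ₗ[k] Y :=
  BalTensor.lift (TensorProduct.lift (LinearMap.flip
    ((Algebra.lsmul k k Y : Aᵐᵒᵖ →ₐ[k] _).toLinearMap ∘ₗ (opLinearEquiv k).toLinearMap ∘ₗ c.α ∘ₗ
      (BalTensor.mk k B).flip n ∘ₗ (coinv k H M).subtype))) (fun y a m => by
    simp [subalgebra_op_smul, coe_smul_coinv, c.α_left])

theorem contract_mk (n : N) (y : Y) (m : coinv k H M) :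
    c.contract n (BalTensor.mk k _ y m) = op (c.α (BalTensor.mk k B (m : M) n)) • y := rfl

theorem contract_sum {ι : Type*} (S : Finset ι) (n : ι → N) (z : CoinvTensor k H A M Y) :
    c.contract (∑ i ∈ S, n i) z = ∑ i ∈ S, c.contract (n i) z := by
  induction z using BalTensor.induction with
  | zero => simp
  | add s t hs ht => simp only [map_add, hs, ht, Finset.sum_add_distrib]
  | tmul y m => simp only [contract_mk, map_sum, Finset.op_sum, Finset.sum_smul]

/-- y α(m' ⊗ n) ⊗ m = y ⊗ α(m' ⊗ n) m = y ⊗ m' β(n ⊗ m). -/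
theorem mk_contract (n : coinv k H N) (m : coinv k H M) (z : CoinvTensor k H A M Y) :
    BalTensor.mk k (coinvAlg k H A) (c.contract (n : N) z) m = op (c.βCoinv n m) • z := by
  induction z using BalTensor.induction with
  | zero => simp
  | add s t hs ht => simp only [map_add, LinearMap.add_apply, smul_add, hs, ht]
  | tmul y m' =>
    change BalTensor.mk k (coinvAlg k H A) (op (c.αCoinv m' n) • y) m = _
    rw [BalTensor.mk_smul, BalTensor.smul_mk]
    congr 1
    exact Subtype.ext (c.α_smul _ _ _)

theorem contract_smul (n : N) (b : coinvAlg k H B) (z : CoinvTensor k H A M Y) :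
    c.contract n (op b • z) = c.contract ((b : B) • n) z := by
  induction z using BalTensor.induction with
  | zero => simp
  | add s t hs ht => simp only [map_add, smul_add, hs, ht]
  | tmul y m =>
    rw [BalTensor.smul_mk, contract_mk, contract_mk, coe_op_smul_coinv, BalTensor.mk_smul]

theorem smul_contract (n : N) (a : A) (z : CoinvTensor k H A M Y) :
    op a • c.contract n z = c.contract (op a • n) z := by
  induction z using BalTensor.induction with
  | zero => simp
  | add s t hs ht => simp only [map_add, smul_add, hs, ht]
  | tmul y m => rw [contract_mk, contract_mk, c.α_right, op_mul, mul_smul]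

/-- m = ∑ α(mᵢ ⊗ nᵢ) m = ∑ mᵢ β(nᵢ ⊗ m): the mᵢ with the functionals β(nᵢ ⊗ -) form a dual basis of
M₀ over B₀. -/
theorem sum_op_βCoinv_smul {S : Finset (coinv k H M × coinv k H N)}
    (hS : ∑ i ∈ S, c.α (BalTensor.mk k B (i.1 : M) (i.2 : N)) = 1) (m : coinv k H M) :
    ∑ i ∈ S, op (c.βCoinv i.2 m) • i.1 = m := by
  apply Subtype.ext
  calc ((∑ i ∈ S, op (c.βCoinv i.2 m) • i.1 : coinv k H M) : M)
      = ∑ i ∈ S, op (c.β (BalTensor.mk k A (i.2 : N) (m : M))) • (i.1 : M) :=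
        map_sum (coinv k H M).subtype _ _
    _ = (m : M) := by
      simp only [← c.α_smul]
      rw [← Finset.sum_smul, hS, one_smul]

theorem homTensorCoinv_bijective {S : Finset (coinv k H M × coinv k H N)}
    (hS : ∑ i ∈ S, c.α (BalTensor.mk k B (i.1 : M) (i.2 : N)) = 1) :
    Function.Bijective (homTensorCoinv k H A B M X Y) := by
  constructor
  · intro f g hfg
    -- Insert 1 = ∑ α(mᵢ ⊗ nᵢ) to the right of f(x).
    have h : ∀ (f : X →ₗ[(coinvAlg k H A)ᵐᵒᵖ] Y) (x : X),
        f x = ∑ i ∈ S, c.contract (i.2 : N)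
          (homTensorCoinv k H A B M X Y f (BalTensor.mk k _ x i.1)) := by
      intro f x
      simp only [homTensorCoinv_mk, contract_mk]
      rw [← Finset.sum_smul, ← Finset.op_sum, hS, op_one, one_smul]
    ext x
    rw [h f, h g, hfg]
  · intro g
    let f : X →ₗ[(coinvAlg k H A)ᵐᵒᵖ] Y :=
      { toFun := fun x => ∑ i ∈ S, c.contract (i.2 : N) (g (BalTensor.mk k _ x i.1))
        map_add' := fun x y => by
          simp only [map_add, LinearMap.add_apply, Finset.sum_add_distrib]
        map_smul' := fun a x => by
          obtain ⟨a, rfl⟩ := op_surjective a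
          -- Expand a mᵢ = ∑ⱼ mⱼ β(nⱼ ⊗ a mᵢ) and pull β through g onto nᵢ: β(nⱼ ⊗ a mᵢ) nᵢ = nⱼ a
          -- α(mᵢ ⊗ nᵢ). Summing over i then leaves nⱼ a.
          have h1 : ∀ i : coinv k H M × coinv k H N,
              c.contract (i.2 : N) (g (BalTensor.mk k _ (op a • x) i.1)) =
              ∑ j ∈ S, c.contract (op ((a : A) * c.α (BalTensor.mk k B (i.1 : M) (i.2 : N))) •
                (j.2 : N)) (g (BalTensor.mk k _ x j.1)) := by
            intro i
            rw [BalTensor.mk_smul, ← c.sum_op_βCoinv_smul hS (a • i.1), map_sum, map_sum, map_sum]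
            refine Finset.sum_congr rfl fun j _ => ?_
            rw [← BalTensor.smul_mk, g.map_smul, contract_smul, ← c.α_left]
            exact congrArg (fun n => c.contract n _) (c.β_smul _ _ _)
          simp only [h1]
          rw [Finset.sum_comm, RingHom.id_apply, Finset.smul_sum]
          refine Finset.sum_congr rfl fun j _ => ?_
          rw [← contract_sum, ← Finset.sum_smul, ← Finset.op_sum, ← Finset.mul_sum, hS, mul_one,
            ← smul_contract]
          rfl }
    have hf : ∀ x, f x = ∑ i ∈ S, c.contract (i.2 : N) (g (BalTensor.mk k _ x i.1)) :=
      fun _ => rfl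
    refine ⟨f, LinearMap.ext fun z => ?_⟩
    induction z using BalTensor.induction with
    | zero => simp
    | add s t hs ht => simp only [map_add, hs, ht]
    | tmul x m =>
      -- By `mk_contract` the left side is ∑ g(x ⊗ mᵢ) β(nᵢ ⊗ m); the dual basis expansion of m
      -- turns g(x ⊗ m) into the same sum.
      rw [homTensorCoinv_mk, hf, map_sum, LinearMap.sum_apply]
      conv_rhs => rw [← c.sum_op_βCoinv_smul hS m, map_sum, map_sum]
      refine Finset.sum_congr rfl fun i _ => ?_
      rw [mk_contract, ← BalTensor.smul_mk, g.map_smul]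

end HMoritaContext

end Morita

/-! ### Compatibility with the Miyashita-Ulbrich actions -/

section Action

variable {k H A B M : Type*} [CommRing k] [Ring H] [HopfAlgebra k H]
  [Ring A] [Algebra k A] [HComoduleAlgebra k H A]
  [Ring B] [Algebra k B] [HComoduleAlgebra k H B]
  [AddCommGroup M] [Module k M] [HComodule k H M]
  [Module A M] [IsScalarTower k A M] [Module Bᵐᵒᵖ M] [IsScalarTower k Bᵐᵒᵖ M]
  [SMulCommClass A Bᵐᵒᵖ M] [IsLeftRelHopf k H A M] [IsRightRelHopf k H B M]
variable {X Y : Type*}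
  [AddCommGroup X] [Module k X] [Module Aᵐᵒᵖ X] [IsScalarTower k Aᵐᵒᵖ X]
  [AddCommGroup Y] [Module k Y] [Module Aᵐᵒᵖ Y] [IsScalarTower k Aᵐᵒᵖ Y]

/-- `can'` is `twist` after `can`, and `twist` sends 1 ⊗ h to 1 ⊗ S(h). -/
theorem can'_gamma (hS : Function.Bijective (HopfAlgebra.antipode k : H →ₗ[k] H))
    (hA : IsRightFFGalois k H A) (h : H) :
    can' k H A (gamma hS hA h) = (1 : A) ⊗ₜ[k] HopfAlgebra.antipode k h := by
  rw [← twist_can, can_gamma, twist_tmul, HComoduleAlgebra.coact_one,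
    Algebra.TensorProduct.tmul_mul_tmul, one_mul, one_mul]

variable (M) in
/-- The map `A ⊗_{A^{co H}} M → Y ⊗_A M`, `a ⊗ m ↦ f(x a) ⊗ m`. -/
def evalTensor (f : X →ₗ[(coinvAlg k H A)ᵐᵒᵖ] Y) (x : X) :
    BalTensor k (coinvAlg k H A) A M →ₗ[k] BalTensor k A Y M :=
  BalTensor.lift (TensorProduct.lift ((BalTensor.mk k A).compl₁₂
    ((f ∘ₗ rightOrbit k H x).restrictScalars k) LinearMap.id)) (fun a c m => by
      simp only [TensorProduct.lift.tmul, LinearMap.compl₁₂_apply,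
        LinearMap.coe_restrictScalars, map_smul, LinearMap.id_apply]
      rw [subalgebra_op_smul, BalTensor.mk_smul, Subalgebra.smul_def])

theorem evalTensor_mk (f : X →ₗ[(coinvAlg k H A)ᵐᵒᵖ] Y) (x : X) (a : A) (m : M) :
    evalTensor M f x (BalTensor.mk k _ a m) = BalTensor.mk k A (f (op a • x)) m := rfl

/-- f(xl)r ⊗ m = f(xl) ⊗ rm over A. -/
theorem mk_sandwich (f : X →ₗ[(coinvAlg k H A)ᵐᵒᵖ] Y) (x : X) (m : M)
    (z : BalTensor k (coinvAlg k H A) A A) :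
    BalTensor.mk k A (sandwich f x z) m = evalTensor M f x (balActOn k H A M m z) := by
  induction z using BalTensor.induction with
  | zero => simp
  | add s t hs ht => simp only [map_add, LinearMap.add_apply, hs, ht]
  | tmul l r => rw [sandwich_mk, balActOn_mk, evalTensor_mk, BalTensor.mk_smul]

theorem evalTensor_smul (f : X →ₗ[(coinvAlg k H A)ᵐᵒᵖ] Y) (x : X) (b : Bᵐᵒᵖ)
    (z : BalTensor k (coinvAlg k H A) A M) :
    evalTensor M f x (b • z) = b • evalTensor M f x z := by
  induction z using BalTensor.induction with
  | zero => simp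
  | add s t hs ht => simp only [map_add, smul_add, hs, ht]
  | tmul a m => rw [BalTensor.smul_mk, evalTensor_mk, evalTensor_mk, BalTensor.smul_mk]

theorem coinvTensorMap_homTensorCoinv_orbit (f : X →ₗ[(coinvAlg k H A)ᵐᵒᵖ] Y) (x : X)
    (t : BalTensor k (coinvAlg k H A) A (coinv k H M)) :
    coinvTensorMap k H A M Y
      (homTensorCoinv k H A B M X Y f (coinvTensorOrbit k H A M x t)) =
      evalTensor M f x (BalTensor.map LinearMap.id (coinvIncl k H A M) t) := by
  induction t using BalTensor.induction with
  | zero => simp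
  | add s t hs ht => simp only [map_add, hs, ht]
  | tmul a m =>
    rw [coinvTensorOrbit_mk, homTensorCoinv_mk, coinvTensorMap_mk, BalTensor.map_mk,
      evalTensor_mk]
    rfl

theorem leftGaloisMap_op_smul (b : B) (z : BalTensor k (coinvAlg k H A) A M) :
    leftGaloisMap k H A M (op b • z) =
      tensorRightAct k H B M (b ⊗ₜ 1) (leftGaloisMap k H A M z) := by
  induction z using BalTensor.induction with
  | zero => simp
  | add s t hs ht => simp only [map_add, smul_add, hs, ht]
  | tmul a m =>
    rw [BalTensor.smul_mk, leftGaloisMap_mk, leftGaloisMap_mk]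
    generalize (coact a : A ⊗[k] H) = t
    induction t with
    | zero => simp
    | add s t hs ht => simp only [map_add, LinearMap.add_apply, hs, ht]
    | tmul a h => simp [tensorLeftAct, tensorRightAct, smul_comm a (op b) m]

theorem tensorRightAct_mul (s t : B ⊗[k] H) (x : M ⊗[k] H) :
    tensorRightAct k H B M (s * t) x = tensorRightAct k H B M t (tensorRightAct k H B M s x) := by
  induction s with
  | zero => simp
  | add s s' hs hs' => simp only [map_add, LinearMap.add_apply, add_mul, hs, hs']
  | tmul a h =>
    induction t with
    | zero => simp
    | add t t' ht ht' => simp only [map_add, LinearMap.add_apply, mul_add, ht, ht']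
    | tmul b g =>
      induction x with
      | zero => simp
      | add x x' hx hx' => simp only [map_add, hx, hx']
      | tmul m u => simp [tensorRightAct, mul_assoc]

variable (B) in
/-- The map `B ⊗ B → A ⊗_{A^{co H}} M`, `l ⊗ r ↦ (m l) r`, where `m l` is regarded as an element
of `A ⊗_{A^{co H}} M^{co H} ≅ M`. -/
noncomputable def splitTensor (hA : IsRightFFGalois k H A) (m : M) :
    B ⊗[k] B →ₗ[k] BalTensor k (coinvAlg k H A) A M :=
  TensorProduct.lift (((Algebra.lsmul k k (BalTensor k (coinvAlg k H A) A M) :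
    Bᵐᵒᵖ →ₐ[k] _).toLinearMap ∘ₗ (opLinearEquiv k).toLinearMap).flip ∘ₗ
      BalTensor.map LinearMap.id (coinvIncl k H A M) ∘ₗ
      (LinearEquiv.ofBijective (coinvStructureMap k H A M)
        (coinvStructureMap_bijective hA)).symm.toLinearMap ∘ₗ
      (LinearMap.toSpanSingleton Bᵐᵒᵖ M m).restrictScalars k ∘ₗ (opLinearEquiv k).toLinearMap)

theorem splitTensor_tmul (hA : IsRightFFGalois k H A) (m : M) (l r : B) :
    splitTensor B hA m (l ⊗ₜ r) = op r • BalTensor.map LinearMap.id (coinvIncl k H A M)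
      ((LinearEquiv.ofBijective (coinvStructureMap k H A M)
        (coinvStructureMap_bijective hA)).symm (op l • m)) := rfl

/-- If ml = ∑ aⱼmⱼ with coinvariant mⱼ, the left side at l ⊗ r is ρ(ml)(r ⊗ 1), which is ml₀r ⊗ l₁
because m is coinvariant. Working with t in B ⊗_k B avoids checking that `splitTensor` is balanced.
-/
theorem leftGaloisMap_splitTensor (hA : IsRightFFGalois k H A) (m : coinv k H M) (t : B ⊗[k] B) :
    leftGaloisMap k H A M (splitTensor B hA (m : M) t) =
      tensorRightAct k H B M (can' k H B (Submodule.Quotient.mk t : BalTensor k (coinvAlg k H B) B B))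
        ((m : M) ⊗ₜ 1) := by
  change _ = tensorRightAct k H B M ((can' k H B ∘ₗ (balRel k (coinvAlg k H B) B B).mkQ) t) _
  induction t with
  | zero => simp
  | add s t hs ht => simp only [map_add, LinearMap.add_apply, hs, ht]
  | tmul l r =>
    have h : (can' k H B ∘ₗ (balRel k (coinvAlg k H B) B B).mkQ) (l ⊗ₜ r) =
        coact l * (r ⊗ₜ[k] (1 : H)) := can'_mk l r
    rw [h, splitTensor_tmul, leftGaloisMap_op_smul, ← coact_coinvStructureMap, tensorRightAct_mul,
      ← mem_coinv.1 m.2, ← IsRightRelHopf.coact_op_smul]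
    congr 2
    exact (LinearEquiv.ofBijective _ (coinvStructureMap_bijective hA)).apply_symm_apply _

/-- With ml = ∑ aⱼmⱼ as above, the transported action gives (x ⊗ m)l = ∑ xaⱼ ⊗ mⱼ. Applying φ(f) and
then r yields ∑ f(xaⱼ) ⊗ mⱼr in Y ⊗_A M. -/
theorem coinvTensorMap_sandwich (hA : IsRightFFGalois k H A)
    (hX : Function.Bijective (coinvTensorMap k H A M X))
    (hY : Function.Bijective (coinvTensorMap k H A M Y))
    (f : X →ₗ[(coinvAlg k H A)ᵐᵒᵖ] Y) (x : X) (m : coinv k H M) (t : B ⊗[k] B) :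
    letI := transportedModule (B := B) hX
    letI := transportedModule (B := B) hY
    haveI := transportedModule_tower (B := B) hX
    haveI := transportedModule_tower (B := B) hY
    haveI := transportedModule_restricted (B := B) hX
    haveI := transportedModule_restricted (B := B) hY
    coinvTensorMap k H A M Y (sandwich (homTensorCoinv k H A B M X Y f) (BalTensor.mk k _ x m)
      (Submodule.Quotient.mk t : BalTensor k (coinvAlg k H B) B B)) =
      evalTensor M f x (splitTensor B hA (m : M) t) := by
  let := transportedModule (B := B) hX
  let := transportedModule (B := B) hY
  have := transportedModule_tower (B := B) hX
  have := transportedModule_tower (B := B) hY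
  have := transportedModule_restricted (B := B) hX
  have := transportedModule_restricted (B := B) hY
  change (coinvTensorMap k H A M Y ∘ₗ
    sandwich (homTensorCoinv k H A B M X Y f) (BalTensor.mk k _ x m) ∘ₗ
    (balRel k (coinvAlg k H B) B B).mkQ) t = (evalTensor M f x ∘ₗ splitTensor B hA (m : M)) t
  congr 1
  refine TensorProduct.ext' fun l r => ?_
  have h1 : op l • (BalTensor.mk k (coinvAlg k H A) x m : CoinvTensor k H A M X) =
      coinvTensorOrbit k H A M x ((LinearEquiv.ofBijective (coinvStructureMap k H A M)
        (coinvStructureMap_bijective hA)).symm (op l • (m : M))) := by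
    apply hX.1
    rw [coinvTensorMap_transported, coinvTensorMap_orbit, coinvTensorMap_mk, BalTensor.smul_mk]
    congr 1
    exact ((LinearEquiv.ofBijective _ (coinvStructureMap_bijective hA)).apply_symm_apply _).symm
  change coinvTensorMap k H A M Y (op r • homTensorCoinv k H A B M X Y f
    (op l • BalTensor.mk k _ x m)) = evalTensor M f x (splitTensor B hA (m : M) (l ⊗ₜ r))
  rw [coinvTensorMap_transported, h1, coinvTensorMap_homTensorCoinv_orbit, splitTensor_tmul,
    evalTensor_smul]

theorem homTensorCoinv_miyashitaUlbrich
    (hS : Function.Bijective (HopfAlgebra.antipode k : H →ₗ[k] H))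
    (hA : IsRightFFGalois k H A) (hB : IsRightFFGalois k H B)
    (hX : Function.Bijective (coinvTensorMap k H A M X))
    (hY : Function.Bijective (coinvTensorMap k H A M Y))
    (f : X →ₗ[(coinvAlg k H A)ᵐᵒᵖ] Y) (h : H) :
    homTensorCoinv k H A B M X Y (miyashitaUlbrich hS hA f h) =
      miyashitaUlbrichTransported hS hB hX hY (homTensorCoinv k H A B M X Y f) h := by
  refine LinearMap.ext fun z => ?_
  induction z using BalTensor.induction with
  | zero => simp
  | add s t hs ht => simp only [map_add, hs, ht]
  | tmul x m =>
    apply hY.1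
    obtain ⟨t, ht⟩ := Submodule.Quotient.mk_surjective _ (gamma hS hB h)
    rw [homTensorCoinv_mk, coinvTensorMap_mk]
    change BalTensor.mk k A (sandwich f x (gamma hS hA h)) (m : M) = _
    have h1 := coinvTensorMap_sandwich hA hX hY f x m t
    rw [ht] at h1
    refine Eq.trans ?_ h1.symm
    rw [mk_sandwich]
    congr 1
    -- It remains to identify ∑ lᵢ ⊗ rᵢm, from γ_A(h), with the element of A ⊗_{A₀} M built from
    -- γ_B(h). Both have image m ⊗ S(h).
    apply leftGaloisMap_injective hA.can'_bijective
    rw [leftGaloisMap_balActOn, can'_gamma, leftGaloisMap_splitTensor, ht, can'_gamma]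
    simp [tensorLeftAct, tensorRightAct]

end Action

end HMorita

theorem proposition6p3 {k H A B M N X Y : Type*}
    [CommRing k] [Ring H] [HopfAlgebra k H]
    (hS : Function.Bijective (HopfAlgebra.antipode k : H →ₗ[k] H))
    [Ring A] [Algebra k A] [HMorita.HComoduleAlgebra k H A]
    [Ring B] [Algebra k B] [HMorita.HComoduleAlgebra k H B]
    (hA : HMorita.IsRightFFGalois k H A) (hB : HMorita.IsRightFFGalois k H B)
    [AddCommGroup M] [Module k M] [HMorita.HComodule k H M]
    [Module A M] [IsScalarTower k A M] [Module Bᵐᵒᵖ M] [IsScalarTower k Bᵐᵒᵖ M]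
    [SMulCommClass A Bᵐᵒᵖ M] [HMorita.IsLeftRelHopf k H A M] [HMorita.IsRightRelHopf k H B M]
    [AddCommGroup N] [Module k N] [HMorita.HComodule k H N]
    [Module B N] [IsScalarTower k B N] [Module Aᵐᵒᵖ N] [IsScalarTower k Aᵐᵒᵖ N]
    [SMulCommClass B Aᵐᵒᵖ N] [HMorita.IsLeftRelHopf k H B N] [HMorita.IsRightRelHopf k H A N]
    (c : HMorita.HMoritaContext k H A B M N) (hc : c.IsStrict)
    [AddCommGroup X] [Module k X] [Module Aᵐᵒᵖ X] [IsScalarTower k Aᵐᵒᵖ X]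
    [AddCommGroup Y] [Module k Y] [Module Aᵐᵒᵖ Y] [IsScalarTower k Aᵐᵒᵖ Y] :
    ∃ (hX : Function.Bijective (HMorita.coinvTensorMap k H A M X))
      (hY : Function.Bijective (HMorita.coinvTensorMap k H A M Y)),
      Function.Bijective (HMorita.homTensorCoinv k H A B M X Y) ∧
      ∀ (f : X →ₗ[(HMorita.coinvAlg k H A)ᵐᵒᵖ] Y) (h : H),
        HMorita.homTensorCoinv k H A B M X Y (HMorita.miyashitaUlbrich hS hA f h) =
          HMorita.miyashitaUlbrichTransported hS hB hX hY
            (HMorita.homTensorCoinv k H A B M X Y f) h := by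
  obtain ⟨S, hS'⟩ := c.exists_sum_αCoinv_eq_one hA hB hc.1.2
  exact ⟨HMorita.coinvTensorMap_bijective hA, HMorita.coinvTensorMap_bijective hA,
    c.homTensorCoinv_bijective hS',
    HMorita.homTensorCoinv_miyashitaUlbrich hS hA hB _ _⟩
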